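/- Let $X$ be an irreducible quasi-projective algebraic variety over $\mathbb{C}$, and let $E_1,\ldots,E_k$ be base-point free linear series on $X$: each $E_i\subset H^0(X,\mathcal{L}_i)$ is a finite-dimensional space of regular sections of a line bundle $\mathcal{L}_i$ such that no point of $X$ is a common zero of all $s\in E_i$. For $J\subset\{1,\ldots,k\}$ let $E_J=\prod_{j\in J}E_j\subset H^0(X,\bigotimes_{j\in J}\mathcal{L}_j)$ be the linear span of all products $\bigotimes_{j\in J}s_j$ with $s_j\in E_j$ (for $J=\varnothing$: the constants), and let $E=E_{\{1,\ldots,k\}}$. For a base-point free linear series $F$ let $\Phi_F:X\to\mathbb{P}(F^*)$ be its Kodaira map, which sends $x$ to the point of $\mathbb{P}(F^*)$ given by the hyperplane $\{s\in F: s(x)=0\}$. Put $\tau_J=\dim\Phi_{E_J}(X)$ and $\operatorname{def}(E_J)=\tau_J-|J|$, and let $d(\mathcal{E})=\min_{J\subset\{1,\ldots,k\}}\operatorname{def}(E_J)$. The collection is called essential if $\operatorname{def}(E_J)>d(\mathcal{E})$ for every proper subset $J\subsetneq\{1,\ldots,k\}$. For a system $\mathbf{s}=(s_1,\ldots,s_k)\in\mathbf{E}=E_1\times\cdots\times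 E_k$ let $Z_{\mathbf{s}}=\{x\in X: s_1(x)=\ldots=s_k(x)=0\}$, and let the consistency variety $R_{\mathbf{E}}\subset\mathbf{E}$ be the Zariski closure of the set of all $\mathbf{s}$ with $Z_{\mathbf{s}}\neq\varnothing$. Suppose that the collection $E_1,\ldots,E_k$ is essential. Then for generic $\mathbf{s}\in R_{\mathbf{E}}$ the zero set $Z_{\mathbf{s}}$ is a single fibre of the Kodaira map $\Phi_E$. That is, there is a Zariski closed proper subset $B\subsetneq R_{\mathbf{E}}$ such that for every $\mathbf{s}\in R_{\mathbf{E}}\setminus B$ there is a point $y\in\Phi_E(X)$ with $Z_{\mathbf{s}}=\Phi_E^{-1}(y)$. -/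

import Mathlib

open scoped LinearAlgebra.Projectivization Topology

namespace LinSys

noncomputable section

/-! ### Zariski topology on affine and projective spaces over `ℂ` -/

section Zariski

variable (V : Type*) [AddCommGroup V] [Module ℂ V]

/-- The algebra of polynomial functions on a complex vector space `V`: the algebra of functions
generated by the linear functionals. -/
def polyFun : Subalgebra ℂ (V → ℂ) :=
  Algebra.adjoin ℂ {f | ∃ φ : Module.Dual ℂ V, f = fun v => φ v}

variable {V}

/-- `f` is a homogeneous polynomial function of degree `d` on `V`. -/
def IsForm (d : ℕ) (f : V → ℂ) : Prop :=
  f ∈ polyFun V ∧ ∀ (c : ℂ) (v : V), f (c • v) = c ^ d * f v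

theorem IsForm.mul {d e : ℕ} {f g : V → ℂ} (hf : IsForm d f) (hg : IsForm e g) :
    IsForm (d + e) (f * g) :=
  ⟨mul_mem hf.1 hg.1, fun c v => by simp only [Pi.mul_apply, hf.2, hg.2, pow_add]; ring⟩

theorem IsForm.add {d : ℕ} {f g : V → ℂ} (hf : IsForm d f) (hg : IsForm d g) :
    IsForm d (f + g) :=
  ⟨add_mem hf.1 hg.1, fun c v => by simp only [Pi.add_apply, hf.2, hg.2]; ring⟩

theorem isForm_const (c : ℂ) : IsForm 0 (algebraMap ℂ (V → ℂ) c) :=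
  ⟨Subalgebra.algebraMap_mem _ c, fun _ _ => by simp⟩

theorem isForm_one : IsForm 0 (1 : V → ℂ) := by
  simpa using isForm_const (V := V) 1

variable (V)

/-- The Zariski topology on the vector space `V`: the closed sets are the common zero sets of
sets of polynomial functions. -/
@[reducible] def zariski : TopologicalSpace V :=
  TopologicalSpace.ofClosed {C | ∃ S ⊆ (polyFun V : Set (V → ℂ)), C = {v | ∀ f ∈ S, f v = 0}}
    ⟨{1}, by simp, by ext; simp⟩
    (fun A hA => by
      refine ⟨{f | f ∈ polyFun V ∧ ∃ C ∈ A, ∀ v ∈ C, f v = 0}, fun f hf => hf.1, ?_⟩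
      ext v
      constructor
      · rintro hv f ⟨-, C, hC, h⟩
        exact h v (hv C hC)
      · intro hv C hC
        obtain ⟨S, hS, rfl⟩ := hA hC
        exact fun f hf => hv f ⟨hS hf, _, hC, fun w hw => hw f hf⟩)
    (by
      rintro A ⟨S, hS, rfl⟩ B ⟨T, hT, rfl⟩
      refine ⟨{h | ∃ f ∈ S, ∃ g ∈ T, h = f * g}, ?_, ?_⟩
      · rintro h ⟨f, hf, g, hg, rfl⟩
        exact mul_mem (hS hf) (hT hg)
      · ext v
        constructor
        · rintro (hv | hv) h ⟨f, hf, g, hg, rfl⟩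
          · simp [hv f hf]
          · simp [hv g hg]
        · intro hv
          by_contra hcon
          simp only [Set.mem_union, Set.mem_ofPred_eq, not_or, not_forall] at hcon
          obtain ⟨⟨f, hf, hf0⟩, g, hg, hg0⟩ := hcon
          exact mul_ne_zero hf0 hg0 (hv _ ⟨f, hf, g, hg, rfl⟩))

/-- The Zariski topology on the projective space `ℙ(V)` of lines in `V`: the closed sets are the
common zero sets of sets of homogeneous polynomial functions on `V`. -/
@[reducible] def zariskiProj : TopologicalSpace (ℙ ℂ V) :=
  TopologicalSpace.ofClosed
    {C | ∃ S : Set (V → ℂ), (∀ f ∈ S, ∃ d, IsForm d f) ∧ C = {p | ∀ f ∈ S, f p.rep = 0}}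
    ⟨{1}, by simpa using ⟨0, isForm_one⟩, by ext; simp⟩
    (fun A hA => by
      refine ⟨{f | (∃ d, IsForm d f) ∧ ∃ C ∈ A, ∀ p ∈ C, f p.rep = 0}, fun f hf => hf.1, ?_⟩
      ext p
      constructor
      · rintro hp f ⟨-, C, hC, h⟩
        exact h p (hp C hC)
      · intro hp C hC
        obtain ⟨S, hS, rfl⟩ := hA hC
        exact fun f hf => hp f ⟨hS f hf, _, hC, fun q hq => hq f hf⟩)
    (by
      rintro A ⟨S, hS, rfl⟩ B ⟨T, hT, rfl⟩
      refine ⟨{h | ∃ f ∈ S, ∃ g ∈ T, h = f * g}, ?_, ?_⟩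
      · rintro h ⟨f, hf, g, hg, rfl⟩
        obtain ⟨d, hd⟩ := hS f hf
        obtain ⟨e, he⟩ := hT g hg
        exact ⟨_, hd.mul he⟩
      · ext p
        constructor
        · rintro (hp | hp) h ⟨f, hf, g, hg, rfl⟩
          · simp [hp f hf]
          · simp [hp g hg]
        · intro hp
          by_contra hcon
          simp only [Set.mem_union, Set.mem_ofPred_eq, not_or, not_forall] at hcon
          obtain ⟨⟨f, hf, hf0⟩, g, hg, hg0⟩ := hcon
          exact mul_ne_zero hf0 hg0 (hp _ ⟨f, hf, g, hg, rfl⟩))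

variable {V}

/-- The dimension of a (nonempty) subset of a projective space: its Krull dimension as a
topological space, for the Zariski topology. It is always a natural number. -/
def projDim (Y : Set (ℙ ℂ V)) : ℕ :=
  letI : TopologicalSpace (ℙ ℂ V) := zariskiProj V
  ((topologicalKrullDim Y).unbotD 0).toNat

end Zariski

/-! ### Quasi-projective varieties and regular functions -/

/-- An irreducible complex quasi-projective variety (identified with its set of closed points):
an irreducible, locally closed subset of a complex projective space. -/
structure QuasiProjVar where
  /-- the dimension of the ambient projective space -/
  N : ℕ
  /-- the underlying set of points -/
  carrier : Set (ℙ ℂ (Fin (N + 1) → ℂ))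
  locallyClosed : @IsLocallyClosed _ (zariskiProj (Fin (N + 1) → ℂ)) carrier
  irreducible : @IsIrreducible _ (zariskiProj (Fin (N + 1) → ℂ)) carrier

/-- The type of points of a variety. -/
def QuasiProjVar.Pt (X : QuasiProjVar) : Type := X.carrier

/-- The Zariski topology of a variety, induced from projective space. -/
instance (X : QuasiProjVar) : TopologicalSpace X.Pt :=
  (zariskiProj (Fin (X.N + 1) → ℂ)).induced Subtype.val

/-- Homogeneous coordinates of a point. -/
def QuasiProjVar.coord {X : QuasiProjVar} (x : X.Pt) : Fin (X.N + 1) → ℂ :=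
  Projectivization.rep (Subtype.val x)

variable {X : QuasiProjVar}

/-- The algebra of regular functions on a subset `W` of `X` (only used for open `W`): the
functions which near every point of `W` are a quotient `F / G` of two homogeneous polynomials of
the same degree in the homogeneous coordinates, with nowhere vanishing denominator. -/
def regularFun (W : Set X.Pt) : Subalgebra ℂ (W → ℂ) where
  carrier := {f | ∀ x : W, ∃ (d : ℕ) (F G : (Fin (X.N + 1) → ℂ) → ℂ) (O : Set X.Pt),
    IsForm d F ∧ IsForm d G ∧ IsOpen O ∧ x.1 ∈ O ∧
      ∀ y : W, y.1 ∈ O → G (X.coord y.1) ≠ 0 ∧ f y = F (X.coord y.1) / G (X.coord y.1)}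
  mul_mem' {f g} hf hg x := by
    obtain ⟨d, F, G, O, hF, hG, hO, hx, h⟩ := hf x
    obtain ⟨d', F', G', O', hF', hG', hO', hx', h'⟩ := hg x
    refine ⟨d + d', F * F', G * G', O ∩ O', hF.mul hF', hG.mul hG', hO.inter hO', ⟨hx, hx'⟩,
      fun y hy => ⟨mul_ne_zero (h y hy.1).1 (h' y hy.2).1, ?_⟩⟩
    simp only [Pi.mul_apply, (h y hy.1).2, (h' y hy.2).2]
    rw [div_mul_div_comm]
  add_mem' {f g} hf hg x := by
    obtain ⟨d, F, G, O, hF, hG, hO, hx, h⟩ := hf x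
    obtain ⟨d', F', G', O', hF', hG', hO', hx', h'⟩ := hg x
    refine ⟨d + d', F * G' + G * F', G * G', O ∩ O', (hF.mul hG').add (hG.mul hF'), hG.mul hG',
      hO.inter hO', ⟨hx, hx'⟩,
      fun y hy => ⟨mul_ne_zero (h y hy.1).1 (h' y hy.2).1, ?_⟩⟩
    simp only [Pi.mul_apply, Pi.add_apply, (h y hy.1).2, (h' y hy.2).2]
    rw [div_add_div _ _ (h y hy.1).1 (h' y hy.2).1]
  algebraMap_mem' c x :=
    ⟨0, algebraMap ℂ _ c, 1, Set.univ, isForm_const c, isForm_one, isOpen_univ, trivial,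
      fun y _ => by simp⟩

/-- Restrictions of regular functions are regular. -/
theorem regularFun_restrict {W W' : Set X.Pt} (h : W' ⊆ W) {f : W → ℂ} (hf : f ∈ regularFun W) :
    (fun y : W' => f (Set.inclusion h y)) ∈ regularFun W' := by
  intro x
  obtain ⟨d, F, G, O, hF, hG, hO, hx, h'⟩ := hf (Set.inclusion h x)
  exact ⟨d, F, G, O, hF, hG, hO, hx, fun y hy => h' (Set.inclusion h y) hy⟩

/-! ### Line bundles and their sections -/

variable (X) in
/-- An algebraic line bundle on `X`, given by an open cover `U` and a cocycle `g` of invertible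
regular functions on the overlaps (`g α β * g β α = g α α = 1`). -/
structure LineBundle where
  /-- the index set of the trivializing cover -/
  ι : Type
  /-- the trivializing cover -/
  U : ι → Set X.Pt
  isOpen_U : ∀ α, IsOpen (U α)
  cover : ∀ x, ∃ α, x ∈ U α
  /-- the transition functions -/
  g : ∀ α β, ↥(U α ∩ U β) → ℂ
  regular : ∀ α β, g α β ∈ regularFun (U α ∩ U β)
  g_self : ∀ α x (h : x ∈ U α), g α α ⟨x, h, h⟩ = 1
  cocycle : ∀ α β γ x (ha : x ∈ U α) (hb : x ∈ U β) (hc : x ∈ U γ),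
    g α β ⟨x, ha, hb⟩ * g β γ ⟨x, hb, hc⟩ = g α γ ⟨x, ha, hc⟩

/-- The space `H⁰(X, L)` of regular sections of `L`: families of regular functions on the members
of the trivializing cover, compatible with the transition functions. -/
def LineBundle.sections (L : LineBundle X) : Submodule ℂ (∀ α, L.U α → ℂ) where
  carrier := {s | (∀ α, s α ∈ regularFun (L.U α)) ∧
    ∀ α β x (ha : x ∈ L.U α) (hb : x ∈ L.U β),
      s α ⟨x, ha⟩ = L.g α β ⟨x, ha, hb⟩ * s β ⟨x, hb⟩}
  add_mem' {s t} hs ht := ⟨fun α => add_mem (hs.1 α) (ht.1 α), fun α β x ha hb => by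
    simp only [Pi.add_apply, hs.2 α β x ha hb, ht.2 α β x ha hb]; ring⟩
  zero_mem' := ⟨fun α => zero_mem _, fun α β x ha hb => by simp⟩
  smul_mem' c {s} hs := ⟨fun α => Subalgebra.smul_mem _ (hs.1 α) c, fun α β x ha hb => by
    simp only [Pi.smul_apply, hs.2 α β x ha hb, smul_eq_mul]; ring⟩

/-- The section `s` of `L` vanishes at the point `x`. -/
def LineBundle.VanishesAt (L : LineBundle X) (s : L.sections) (x : X.Pt) : Prop :=
  ∀ α (h : x ∈ L.U α), s.1 α ⟨x, h⟩ = 0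

/-- Vanishing of a section can be checked in one trivialization. -/
theorem LineBundle.vanishesAt_iff (L : LineBundle X) (s : L.sections) (x : X.Pt) (α : L.ι)
    (h : x ∈ L.U α) : L.VanishesAt s x ↔ s.1 α ⟨x, h⟩ = 0 :=
  ⟨fun hs => hs α h, fun hs β hb => by rw [s.2.2 β α x hb h, hs, mul_zero]⟩

section Tensor

variable {κ : Type} [Fintype κ]

/-- The tensor product of a finite family of line bundles: the trivializing cover consists of the
intersections of members of the given covers, the transition functions are multiplied. -/
def LineBundle.tensor (L : κ → LineBundle X) : LineBundle X where
  ι := ∀ j, (L j).ι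
  U a := ⋂ j, (L j).U (a j)
  isOpen_U a := isOpen_iInter_of_finite fun j => (L j).isOpen_U (a j)
  cover x := by
    choose a ha using fun j => (L j).cover x
    exact ⟨a, Set.mem_iInter.2 ha⟩
  g a b x := ∏ j, (L j).g (a j) (b j)
    ⟨x.1, Set.mem_iInter.1 x.2.1 j, Set.mem_iInter.1 x.2.2 j⟩
  regular a b := by
    have h : ∀ j, (⋂ j, (L j).U (a j)) ∩ (⋂ j, (L j).U (b j)) ⊆
        (L j).U (a j) ∩ (L j).U (b j) := fun j x hx =>
      ⟨Set.mem_iInter.1 hx.1 j, Set.mem_iInter.1 hx.2 j⟩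
    have := Subalgebra.prod_mem (regularFun ((⋂ j, (L j).U (a j)) ∩ (⋂ j, (L j).U (b j))))
      (t := Finset.univ) fun j _ => regularFun_restrict (h j) ((L j).regular (a j) (b j))
    convert this using 1
    funext x
    simp [Set.inclusion]
  g_self a x h := Finset.prod_eq_one fun j _ => (L j).g_self _ _ (Set.mem_iInter.1 h j)
  cocycle a b c x ha hb hc := by
    rw [← Finset.prod_mul_distrib]
    exact Finset.prod_congr rfl fun j _ => (L j).cocycle _ _ _ x (Set.mem_iInter.1 ha j)
      (Set.mem_iInter.1 hb j) (Set.mem_iInter.1 hc j)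

/-- The product `⊗ⱼ sⱼ` of sections `sⱼ` of the line bundles `Lⱼ`, as a section of their tensor
product. -/
def LineBundle.tensorSection (L : κ → LineBundle X) (s : ∀ j, (L j).sections) :
    (LineBundle.tensor L).sections :=
  ⟨fun a x => ∏ j, (s j).1 (a j) ⟨x.1, Set.mem_iInter.1 x.2 j⟩, by
    intro a
    have h : ∀ j, (⋂ j, (L j).U (a j)) ⊆ (L j).U (a j) := fun j x hx => Set.mem_iInter.1 hx j
    have := Subalgebra.prod_mem (regularFun (⋂ j, (L j).U (a j)))
      (t := Finset.univ) fun j _ => regularFun_restrict (h j) ((s j).2.1 (a j))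
    change (fun x : ↥(⋂ j, (L j).U (a j)) => ∏ j, (s j).1 (a j) ⟨x.1, Set.mem_iInter.1 x.2 j⟩) ∈
      regularFun (⋂ j, (L j).U (a j))
    convert this using 1
    funext x
    simp [Set.inclusion], by
    intro a b x ha hb
    simp only [LineBundle.tensor]
    rw [← Finset.prod_mul_distrib]
    exact Finset.prod_congr rfl fun j _ =>
      (s j).2.2 _ _ x (Set.mem_iInter.1 ha j) (Set.mem_iInter.1 hb j)⟩

theorem LineBundle.tensorSection_update [DecidableEq κ] (L : κ → LineBundle X)
    (s : ∀ j, (L j).sections) (j : κ) (z : (L j).sections) (a : ∀ j, (L j).ι)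
    (p : ↥(⋂ j, (L j).U (a j))) :
    (LineBundle.tensorSection L (Function.update s j z)).1 a p =
      z.1 (a j) ⟨p.1, Set.mem_iInter.1 p.2 j⟩ *
        ∏ i ∈ Finset.univ.erase j, (s i).1 (a i) ⟨p.1, Set.mem_iInter.1 p.2 i⟩ := by
  change ∏ i, (Function.update s j z i).1 (a i) ⟨p.1, Set.mem_iInter.1 p.2 i⟩ = _
  rw [← Finset.mul_prod_erase _ _ (Finset.mem_univ j), Function.update_self]
  congr 1
  exact Finset.prod_congr rfl fun i hi => by
    rw [Function.update_of_ne (Finset.ne_of_mem_erase hi)]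

/-- The product of sections, as a multilinear map. -/
def LineBundle.tensorMultilinear (L : κ → LineBundle X) :
    MultilinearMap ℂ (fun j => (L j).sections) (LineBundle.tensor L).sections where
  toFun := LineBundle.tensorSection L
  map_update_add' s j x y := Subtype.ext <| funext fun a => funext fun p => by
    refine (tensorSection_update L s j (x + y) a p).trans (Eq.trans ?_
      (congrArg₂ (· + ·) (tensorSection_update L s j x a p)
        (tensorSection_update L s j y a p)).symm)
    exact add_mul _ _ _
  map_update_smul' s j c x := Subtype.ext <| funext fun a => funext fun p => by
    refine (tensorSection_update L s j (c • x) a p).trans (Eq.trans ?_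
      (congrArg (c • ·) (tensorSection_update L s j x a p)).symm)
    exact mul_assoc _ _ _

/-- The values of a multilinear map on finite-dimensional subspaces span a finite-dimensional
space. -/
theorem finite_span_image {M : κ → Type*} {N : Type*} [∀ j, AddCommGroup (M j)]
    [∀ j, Module ℂ (M j)] [AddCommGroup N] [Module ℂ N] (m : MultilinearMap ℂ M N)
    (F : ∀ j, Submodule ℂ (M j)) [hF : ∀ j, Module.Finite ℂ (F j)] :
    FiniteDimensional ℂ (Submodule.span ℂ {y | ∃ s, (∀ j, s j ∈ F j) ∧ y = m s}) := by
  choose n v hv using fun j => Module.Finite.exists_fin (R := ℂ) (M := F j)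
  have ht : Module.Finite ℂ (PiTensorProduct ℂ fun j => Fin (n j) → ℂ) := PiTensorProduct.finite
  let φ : ∀ j, (Fin (n j) → ℂ) →ₗ[ℂ] M j := fun j =>
    (F j).subtype ∘ₗ Fintype.linearCombination ℂ (v j)
  have hφ : ∀ j, ∀ x ∈ F j, ∃ c, φ j c = x := by
    intro j x hx
    have h : (⟨x, hx⟩ : F j) ∈ Submodule.span ℂ (Set.range (v j)) := by rw [hv]; trivial
    rw [← Fintype.range_linearCombination] at h
    obtain ⟨c, hc⟩ := h
    exact ⟨c, congrArg Subtype.val hc⟩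
  refine Submodule.finiteDimensional_of_le
    (S₂ := LinearMap.range (PiTensorProduct.lift (m.compLinearMap φ))) ?_
  rw [Submodule.span_le]
  rintro _ ⟨s, hs, rfl⟩
  choose c hc using fun j => hφ j (s j) (hs j)
  refine ⟨PiTensorProduct.tprod ℂ c, ?_⟩
  rw [PiTensorProduct.lift.tprod, MultilinearMap.compLinearMap_apply]
  exact congrArg m (funext hc)

end Tensor

/-! ### Linear series and Kodaira maps -/

variable (X) in
/-- A base-point free linear series on `X`: a finite-dimensional space `E` of regular sections of
a line bundle `L`, without common zeros on `X`. -/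
structure LinearSeries where
  /-- the line bundle -/
  L : LineBundle X
  /-- the space of sections -/
  E : Submodule ℂ L.sections
  finite : FiniteDimensional ℂ E
  basePointFree : ∀ x, ∃ s ∈ E, ¬ L.VanishesAt s x

namespace LinearSeries

/-- A member `s` of the linear series vanishes at `x`. -/
def VanishesAt (S : LinearSeries X) (s : S.E) (x : X.Pt) : Prop := S.L.VanishesAt s.1 x

/-- Evaluation of the members of the series at `x`, in the trivialization with index `α`. -/
def ev (S : LinearSeries X) (x : X.Pt) (α : S.L.ι) (h : x ∈ S.L.U α) : Module.Dual ℂ S.E where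
  toFun s := s.1.1 α ⟨x, h⟩
  map_add' _ _ := rfl
  map_smul' _ _ := rfl

theorem ev_ne_zero (S : LinearSeries X) (x : X.Pt) (α : S.L.ι) (h : x ∈ S.L.U α) :
    S.ev x α h ≠ 0 := by
  intro h0
  obtain ⟨s, hs, hx⟩ := S.basePointFree x
  exact hx ((S.L.vanishesAt_iff s x α h).2 (LinearMap.congr_fun h0 (⟨s, hs⟩ : S.E)))

/-- The Kodaira map `Φ_E : X → ℙ(E*)`. It sends `x` to the point of `ℙ(E*)` which corresponds to
the hyperplane of the members of `E` vanishing at `x`, that is, to the line in `E*` spanned by the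
evaluation at `x`; see `kodaira_eq_mk` and `kodaira_apply_eq_zero_iff`. -/
def kodaira (S : LinearSeries X) (x : X.Pt) : ℙ ℂ (Module.Dual ℂ S.E) :=
  Projectivization.mk ℂ _ (S.ev_ne_zero x _ (S.L.cover x).choose_spec)

/-- The Kodaira map does not depend on the trivializations. -/
theorem kodaira_eq_mk (S : LinearSeries X) (x : X.Pt) (α : S.L.ι) (h : x ∈ S.L.U α) :
    S.kodaira x = Projectivization.mk ℂ (S.ev x α h) (S.ev_ne_zero x α h) := by
  rw [kodaira, Projectivization.mk_eq_mk_iff']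
  refine ⟨S.L.g _ α ⟨x, (S.L.cover x).choose_spec, h⟩, ?_⟩
  ext s
  exact (s.1.2.2 _ _ x (S.L.cover x).choose_spec h).symm

/-- The hyperplane of `E` given by `Φ_E(x)` consists of the members of `E` vanishing at `x`. -/
theorem kodaira_apply_eq_zero_iff (S : LinearSeries X) (x : X.Pt) (s : S.E) :
    (S.kodaira x).rep s = 0 ↔ S.VanishesAt s x := by
  obtain ⟨α, h⟩ := S.L.cover x
  obtain ⟨c, hc⟩ := Projectivization.exists_smul_eq_mk_rep ℂ (S.ev x α h) (S.ev_ne_zero x α h)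
  rw [S.kodaira_eq_mk x α h, ← hc, VanishesAt, S.L.vanishesAt_iff _ _ α h]
  simp [Units.smul_def, ev]

section Product

variable {κ : Type} [Fintype κ]

/-- The product `∏ⱼ Eⱼ` of linear series: the space of sections of `⊗ⱼ Lⱼ` spanned by the products
`⊗ⱼ sⱼ` with `sⱼ ∈ Eⱼ`. -/
def prod (S : κ → LinearSeries X) : LinearSeries X where
  L := LineBundle.tensor fun j => (S j).L
  E := Submodule.span ℂ {σ | ∃ s : ∀ j, (S j).L.sections, (∀ j, s j ∈ (S j).E) ∧
    σ = LineBundle.tensorSection (fun j => (S j).L) s}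
  finite := by
    have hfin : ∀ j, Module.Finite ℂ (S j).E := fun j => (S j).finite
    exact finite_span_image (LineBundle.tensorMultilinear fun j => (S j).L) fun j => (S j).E
  basePointFree x := by
    choose s hs hx using fun j => (S j).basePointFree x
    refine ⟨_, Submodule.subset_span ⟨s, hs, rfl⟩, ?_⟩
    choose a ha using fun j => (S j).L.cover x
    rw [LineBundle.vanishesAt_iff _ _ x a (Set.mem_iInter.2 ha)]
    exact Finset.prod_ne_zero_iff.2 fun j _ =>
      fun h => hx j (((S j).L.vanishesAt_iff (s j) x (a j) (ha j)).2 h)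

end Product

end LinearSeries

/-! ### Collections of linear series -/

section Collections

variable {k : ℕ} (E : Fin k → LinearSeries X)

/-- The product `E_J = ∏_{j ∈ J} E_j` of a subcollection. -/
def subProd (J : Finset (Fin k)) : LinearSeries X :=
  LinearSeries.prod fun j : J => E j

/-- `τ_J`, the dimension of the image `Y_J` of the Kodaira map of `E_J`. -/
def tau (J : Finset (Fin k)) : ℕ := projDim (Set.range (subProd E J).kodaira)

/-- The defect `def(E_J) = τ_J - |J|` of a subcollection. -/
def defect (J : Finset (Fin k)) : ℤ := tau E J - J.card

/-- The minimal defect `d(E)`: the minimum of the defects of all subcollections. -/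
def minDefect : ℤ := Finset.univ.inf' Finset.univ_nonempty (defect E)

/-- The collection is essential: `def(E_J) > d(E)` for every proper subcollection `J`. -/
def IsEssential : Prop := ∀ J : Finset (Fin k), J ⊂ Finset.univ → minDefect E < defect E J

/-- The space `E_1 × ⋯ × E_k` of systems. -/
abbrev Systems : Type := ∀ i, (E i).E

/-- The incidence variety. -/
def incidence : Set (X.Pt × Systems E) := {q | ∀ i, (E i).VanishesAt (q.2 i) q.1}

/-- The consistency variety: the Zariski closure, in the space of systems, of the image of the
incidence variety, i.e. of the set of systems which have a common root on `X`. -/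
def consistencyVariety : Set (Systems E) :=
  closure[zariski (Systems E)] (Prod.snd '' incidence E)

/-- The zero set `Z_s ⊆ X` of the system `s_1 = ⋯ = s_k = 0`. -/
def zeroSet (s : Systems E) : Set X.Pt := {x | ∀ i, (E i).VanishesAt (s i) x}

end Collections

end

end LinSys

/-! ### Commutative algebra: points of finitely generated algebras and Krull dimension. -/

namespace LinSys
section CommAlg

/-! The theorem rests on a parameter count at a generic consistent system. Choose an affine open
subset of X with coordinate ring A on which no member of chosen bases of the E_i vanishes. There the
equation s_i(x) = 0 can be solved for one coefficient of s_i, so the incidence variety over this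
subset has coordinate ring A[u], where u runs over the N remaining coefficients. It is irreducible,
and the kernel of `theta`, from polynomials in the coefficients to A[u], is the ideal of the
consistency variety (`mem_consistencyVariety_iff`). Embedding A[u] in an algebraically closed field
Ω gives a generic system s with a generic root ρ, and the transcendence degree of (ρ, s) is τ + N,
where τ belongs to the whole collection.

Let v be another root of s over Ω that satisfies all relations of the generic point of X, and let J
be the set of i for which ρ and v agree in ℙ(E_i*). The coordinates with index in J are common to
both points, so submodularity gives trdeg(ρ, v) ≤ 2τ - τ_J. For i ∉ J the equation s_i(v) = 0 is
independent of s_i(ρ) = 0 and determines one more coefficient. Hence τ + N ≤ 2τ - τ_J + N - (k -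
|J|), that is def(E_J) ≤ def(E) (`algRank_count`). Essentiality allows this only if J is everything
(`eq_of_generic_root`). The link with τ_J as a Krull dimension is `tau_eq_algRank`.

To pass from generic to general systems, suppose that pairs of roots with different images exist off
every hypersurface of the consistency variety. Then the generic system lifts to such a pair over Ω,
which is impossible (`exists_ratio_eq_of_general`). A general system has a root by Chevalley's
theorem (`exists_root_of_general`), and its zero set contains the whole fibre of that root because
Φ_E(x) decides which members of each E_i vanish at x. -/

theorem nonempty_algHom_of_finiteType (K B Ω : Type*) [Field K] [CommRing B] [Nontrivial B]
    [Algebra K B] [Algebra.FiniteType K B] [Field Ω] [IsAlgClosed Ω] [Algebra K Ω] :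
    Nonempty (B →ₐ[K] Ω) := by
  obtain ⟨m, hm⟩ := Ideal.exists_maximal B
  let := Ideal.Quotient.field m
  have := finite_of_finite_type_of_isJacobsonRing K (B ⧸ m)
  exact ⟨(IsAlgClosed.lift : B ⧸ m →ₐ[K] Ω).comp (Ideal.Quotient.mkₐ K m)⟩

/-- Two homomorphisms to the ground field with nested kernels agree. -/
theorem algHom_eq_of_ker_le {K C : Type*} [Field K] [CommRing C] [Algebra K C]
    (φ ψ : C →ₐ[K] K) (h : ∀ c, φ c = 0 → ψ c = 0) : ψ = φ := by
  ext c
  have := h (c - algebraMap K C (φ c)) (by simp)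
  simpa [sub_eq_zero] using this

/-- In a finitely generated algebra, the points of an irreducible closed set outside a
hypersurface not containing it. -/
theorem exists_algHom_prime {K A : Type*} [Field K] [IsAlgClosed K] [CommRing A] [Algebra K A]
    [Algebra.FiniteType K A] (p : Ideal A) [p.IsPrime] (f : A) (hf : f ∉ p) :
    ∃ φ : A →ₐ[K] K, (∀ g ∈ p, φ g = 0) ∧ φ f ≠ 0 := by
  -- A point of this localization is a point of the zero set of `p` at which `f` is invertible.
  let B := Localization.Away (Ideal.Quotient.mk p f)
  have hf0 : Ideal.Quotient.mk p f ≠ 0 := by rwa [Ne, Ideal.Quotient.eq_zero_iff_mem]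
  have : Nontrivial B := by
    have := IsLocalization.isDomain_localization (M := Submonoid.powers (Ideal.Quotient.mk p f))
      (powers_le_nonZeroDivisors_of_noZeroDivisors hf0)
    infer_instance
  have h1 : Algebra.FiniteType (A ⧸ p) B :=
    IsLocalization.finiteType_of_monoid_fg (Submonoid.powers (Ideal.Quotient.mk p f)) _
  have h2 : Algebra.FiniteType K B := Algebra.FiniteType.trans (S := A ⧸ p) inferInstance h1
  obtain ⟨ψ⟩ := nonempty_algHom_of_finiteType K B K
  let χ : A →ₐ[K] K := ψ.comp ((IsScalarTower.toAlgHom K (A ⧸ p) B).comp (Ideal.Quotient.mkₐ K p))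
  refine ⟨χ, fun g hg => ?_, ?_⟩
  · simp only [χ, AlgHom.comp_apply, Ideal.Quotient.mkₐ_eq_mk, Ideal.Quotient.eq_zero_iff_mem.2 hg,
      map_zero]
  · have : IsUnit (algebraMap (A ⧸ p) B (Ideal.Quotient.mk p f)) :=
      IsLocalization.Away.algebraMap_isUnit _
    exact (this.map ψ).ne_zero

/-- The generic point lies in one of the locally closed pieces. In a domain the closed conditions of
that piece then read `0 = 0`, and only the nonvanishing of one element remains. -/
theorem exists_basicOpen_subset_of_isConstructible {R : Type*} [CommRing R] [IsDomain R]
    {S : Set (PrimeSpectrum R)} (hS : Topology.IsConstructible S) (h : ⊥ ∈ S) :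
    ∃ a : R, a ≠ 0 ∧ (PrimeSpectrum.basicOpen a : Set (PrimeSpectrum R)) ⊆ S := by
  obtain ⟨D, rfl⟩ := PrimeSpectrum.exists_constructibleSetData_iff.2 hS
  obtain ⟨C, hC, hb⟩ := Set.mem_iUnion₂.1 h
  refine ⟨C.f, ?_, fun p hp => Set.mem_iUnion₂.2 ⟨C, hC, ?_⟩⟩
  · intro h0
    exact hb.2 (by rw [h0]; simp)
  · refine ⟨?_, by simpa using hp⟩
    have : Set.range C.g ⊆ {0} := fun x hx => by
      have := hb.1 hx
      simpa using this
    exact fun x hx => by rw [Set.mem_singleton_iff.1 (this hx)]; exact zero_mem _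

/-- Homomorphisms to an algebraically closed ground field extend along a dominant morphism,
outside a hypersurface. -/
theorem exists_extension {K C B : Type*} [Field K] [IsAlgClosed K] [CommRing C] [Algebra K C]
    [Algebra.FiniteType K C] [CommRing B] [IsDomain B] [Algebra K B] [Algebra.FiniteType K B]
    (f : C →ₐ[K] B) :
    ∃ a, f a ≠ 0 ∧ ∀ φ : C →ₐ[K] K, (∀ c, f c = 0 → φ c = 0) → φ a ≠ 0 →
      ∃ ψ : B →ₐ[K] K, ∀ c, ψ (f c) = φ c := by
  have hfg : Algebra.FiniteType K f.range :=
    Algebra.FiniteType.of_surjective f.rangeRestrict f.rangeRestrict_surjective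
  have : IsNoetherianRing f.range := Algebra.FiniteType.isNoetherianRing K f.range
  have hft : Algebra.FiniteType f.range B :=
    Algebra.FiniteType.of_restrictScalars_finiteType K f.range B
  have hfp : (algebraMap f.range B).FinitePresentation :=
    RingHom.FinitePresentation.of_finiteType.1 (RingHom.finiteType_algebraMap.2 hft)
  -- Chevalley's theorem: the image of the spectrum of `B` is constructible. It contains the zero
  -- ideal because `B` is a domain, hence it contains a basic open set.
  have hcon := PrimeSpectrum.isConstructible_range_comap hfp
  obtain ⟨⟨_, a, rfl⟩, ha, hsub⟩ := exists_basicOpen_subset_of_isConstructible hcon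
    ⟨⊥, PrimeSpectrum.ext <| by
      ext x
      simp⟩
  refine ⟨a, fun h => ha (Subtype.ext h), fun φ hφ hφa => ?_⟩
  have hker : RingHom.ker f.rangeRestrict ≤ RingHom.ker φ := fun c hc =>
    hφ c (congrArg Subtype.val (RingHom.mem_ker.1 hc))
  let φ' : f.range →ₐ[K] K :=
    AlgHom.liftOfSurjective f.rangeRestrict f.rangeRestrict_surjective φ hker
  have hφ' : ∀ c, φ' (f.rangeRestrict c) = φ c := fun c =>
    AlgHom.liftOfSurjective_apply ..
  have hprime : (RingHom.ker φ').IsPrime := RingHom.ker_isPrime _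
  obtain ⟨Q, hQ⟩ := @hsub ⟨RingHom.ker φ', hprime⟩ (by
    change f.rangeRestrict a ∉ RingHom.ker φ'
    rw [RingHom.mem_ker, hφ']
    exact hφa)
  obtain ⟨ψ⟩ := nonempty_algHom_of_finiteType K (B ⧸ Q.asIdeal) K
  let χ : B →ₐ[K] K := ψ.comp (Ideal.Quotient.mkₐ K Q.asIdeal)
  refine ⟨χ, ?_⟩
  have : χ.comp f.range.val = φ' := algHom_eq_of_ker_le _ _ fun c hc => by
    have : c ∈ (PrimeSpectrum.comap (algebraMap f.range B) Q).asIdeal := by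
      rw [hQ]; exact hc
    have hc' : (c : B) ∈ Q.asIdeal := this
    change ψ (Ideal.Quotient.mk _ _) = 0
    erw [Ideal.Quotient.eq_zero_iff_mem.2 hc', map_zero]
  intro c
  rw [← hφ' c, ← this]
  rfl

/-- Injectivity of `R → B` makes the generic fibre `F ⊗ B` nonzero, and this is a finitely generated
algebra over a field that maps to `Ω`. -/
theorem nonempty_algHom_of_faithfulSMul (R B Ω : Type*) [CommRing R] [IsDomain R] [CommRing B]
    [Algebra R B] [FaithfulSMul R B] [Algebra.FiniteType R B] [Field Ω] [IsAlgClosed Ω]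
    [Algebra R Ω] [FaithfulSMul R Ω] : Nonempty (B →ₐ[R] Ω) := by
  let F := FractionRing R
  let : Algebra F Ω := FractionRing.liftAlgebra R Ω
  have : IsScalarTower R F Ω := FractionRing.isScalarTower_liftAlgebra R Ω
  have hnt : Nontrivial (TensorProduct R F B) := by
    have := Algebra.TensorProduct.includeLeft_injective (R := R) (S := F) (A := F) (B := B)
      (FaithfulSMul.algebraMap_injective R B)
    exact this.nontrivial
  obtain ⟨ψ⟩ := nonempty_algHom_of_finiteType F (TensorProduct R F B) Ω
  exact ⟨(ψ.restrictScalars R).comp Algebra.TensorProduct.includeRight⟩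

/-- A generic point of the target of a dominant morphism lifts to the source. -/
theorem exists_lift_generic {K C B Ω : Type*} [Field K] [CommRing C] [Algebra K C]
    [CommRing B] [Algebra K B] [Algebra.FiniteType K B]
    [Field Ω] [IsAlgClosed Ω] [Algebra K Ω] (f : C →ₐ[K] B) (g : C →ₐ[K] Ω)
    (h : ∀ c, f c = 0 ↔ g c = 0) : ∃ χ : B →ₐ[K] Ω, ∀ c, χ (f c) = g c := by
  have hker : RingHom.ker f.rangeRestrict ≤ RingHom.ker g := fun c hc =>
    (h c).1 (congrArg Subtype.val (RingHom.mem_ker.1 hc))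
  let g' : f.range →ₐ[K] Ω :=
    AlgHom.liftOfSurjective f.rangeRestrict f.rangeRestrict_surjective g hker
  have hg' : ∀ c, g' (f.rangeRestrict c) = g c := fun c =>
    AlgHom.liftOfSurjective_apply ..
  -- Equal kernels embed the image of `f` in `Ω`. This image is therefore a domain, although `B`
  -- need not be one.
  have hinj : Function.Injective g' := by
    rw [injective_iff_map_eq_zero]
    rintro ⟨_, c, rfl⟩ hc
    exact Subtype.ext ((h c).2 ((hg' c).symm.trans hc))
  have hdom : IsDomain f.range := hinj.isDomain g'.toRingHom
  let : Algebra f.range Ω := g'.toRingHom.toAlgebra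
  have : FaithfulSMul f.range Ω := (faithfulSMul_iff_algebraMap_injective _ _).2 hinj
  have hft : Algebra.FiniteType f.range B :=
    Algebra.FiniteType.of_restrictScalars_finiteType K f.range B
  obtain ⟨χ'⟩ := nonempty_algHom_of_faithfulSMul f.range B Ω
  have hχ : ∀ c, χ' (f c) = g c := fun c => by
    rw [← hg' c]
    exact χ'.commutes (f.rangeRestrict c)
  refine ⟨{ χ'.toRingHom with commutes' := fun r => ?_ }, hχ⟩
  have := hχ (algebraMap K C r)
  rw [f.commutes, g.commutes] at this
  exact this

/-- Incomparability makes contraction of primes strictly monotone. -/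
theorem ringKrullDim_le_of_isIntegral (R A : Type*) [CommRing R] [CommRing A] [Algebra R A]
    [Algebra.IsIntegral R A] : ringKrullDim A ≤ ringKrullDim R :=
  Order.krullDim_le_of_strictMono (PrimeSpectrum.comap (algebraMap R A)) fun p _ h =>
    Ideal.IsIntegral.comap_lt_comap (I := p.asIdeal) h

/-- Lying over provides a prime above the smallest member of a chain, and going up lifts the rest.
-/
theorem ringKrullDim_le_of_isIntegral_of_injective (R A : Type*) [CommRing R] [CommRing A]
    [Algebra R A] [Algebra.IsIntegral R A] [FaithfulSMul R A] :
    ringKrullDim R ≤ ringKrullDim A := by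
  refine iSup_le fun l => ?_
  obtain ⟨P, -, hP, hcomap⟩ := Ideal.exists_ideal_over_prime_of_isIntegral (S := A)
    l.head.asIdeal ⊥ (by
      rw [← RingHom.ker_eq_comap_bot,
        (RingHom.injective_iff_ker_eq_bot _).1 (FaithfulSMul.algebraMap_injective R A)]
      exact bot_le)
  have : P.LiesOver (RelSeries.head l).asIdeal := ⟨hcomap.symm⟩
  obtain ⟨L, hL, -⟩ := Ideal.exists_ltSeries_of_hasGoingUp l P
  rw [← hL]
  exact Order.LTSeries.length_le_krullDim L

/-- The Krull dimension of a finitely generated domain over a field is its transcendence degree. -/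
theorem ringKrullDim_eq_trdeg (K A : Type*) [Field K] [CommRing A] [IsDomain A] [Algebra K A]
    [Algebra.FiniteType K A] :
    ringKrullDim A = ((Cardinal.toENat (Algebra.trdeg K A) : ℕ∞) : WithBot ℕ∞) := by
  -- Noether normalization: both invariants equal the number `s` of variables.
  obtain ⟨s, g, hg, hint⟩ := exists_integral_inj_algHom_of_fg K A
  let : Algebra (MvPolynomial (Fin s) K) A := g.toRingHom.toAlgebra
  have : IsScalarTower K (MvPolynomial (Fin s) K) A :=
    IsScalarTower.of_algebraMap_eq fun x => (g.commutes x).symm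
  have : Algebra.IsIntegral (MvPolynomial (Fin s) K) A := ⟨hint⟩
  have : FaithfulSMul (MvPolynomial (Fin s) K) A :=
    (faithfulSMul_iff_algebraMap_injective _ _).2 hg
  have h1 : ringKrullDim A = s := by
    rw [le_antisymm (ringKrullDim_le_of_isIntegral (MvPolynomial (Fin s) K) A)
      (ringKrullDim_le_of_isIntegral_of_injective (MvPolynomial (Fin s) K) A),
      MvPolynomial.ringKrullDim_of_isNoetherianRing, ringKrullDim_eq_zero_of_field]
    simp
  have h2 := lift_trdeg_add_eq K (MvPolynomial (Fin s) K) A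
  rw [trdeg_eq_zero (R := MvPolynomial (Fin s) K) (A := A),
    MvPolynomial.trdeg_of_isDomain] at h2
  have h3 := congrArg Cardinal.toENat h2
  simp only [Cardinal.mk_fin, Cardinal.lift_natCast, Cardinal.lift_zero, add_zero,
    map_natCast, Cardinal.toENat_lift] at h3
  rw [h1, ← h3]
  rfl

/-- A maximal chain of primes can be found outside a given hypersurface. -/
theorem exists_ltSeries_notMem (K A : Type*) [Field K] [CommRing A] [IsDomain A] [Algebra K A]
    [Algebra.FiniteType K A] (a : A) (ha : a ≠ 0) (n : ℕ)
    (hn : (n : ℕ∞) ≤ Cardinal.toENat (Algebra.trdeg K A)) :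
    ∃ l : LTSeries (PrimeSpectrum A), l.length = n ∧ ∀ i, a ∉ (l i).asIdeal := by
  -- The primes of this localization are the primes avoiding `a`, and inverting `a` preserves the
  -- transcendence degree.
  let B := Localization.Away a
  have hle : Submonoid.powers a ≤ nonZeroDivisors A :=
    powers_le_nonZeroDivisors_of_noZeroDivisors ha
  have : IsDomain B := IsLocalization.isDomain_localization hle
  have h1 : Algebra.FiniteType A B :=
    IsLocalization.finiteType_of_monoid_fg (Submonoid.powers a) _
  have h2 : Algebra.FiniteType K B := Algebra.FiniteType.trans (S := A) inferInstance h1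
  have : FaithfulSMul A B :=
    (faithfulSMul_iff_algebraMap_injective _ _).2 (IsLocalization.injective B hle)
  have : Algebra.IsAlgebraic A B := IsLocalization.isAlgebraic B (Submonoid.powers a)
  have htr : Algebra.trdeg K B = Algebra.trdeg K A := by
    rw [← trdeg_add_eq K A (A := B), trdeg_eq_zero (R := A) (A := B), add_zero]
  have hdim := ringKrullDim_eq_trdeg K B
  rw [htr] at hdim
  obtain ⟨l, hl⟩ := (Order.le_krullDim_iff (n := n) (α := PrimeSpectrum B)).1 (by
    change _ ≤ ringKrullDim B
    rw [hdim]
    exact_mod_cast hn)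
  refine ⟨l.map (PrimeSpectrum.comap (algebraMap A B)) ?_, hl, fun i hi => ?_⟩
  · refine Monotone.strictMono_of_injective (fun p q h => Ideal.comap_mono h)
      (PrimeSpectrum.localization_comap_injective B (Submonoid.powers a))
  · have : IsUnit (algebraMap A B a) := IsLocalization.Away.algebraMap_isUnit _
    exact (l i).2.ne_top (Ideal.eq_top_of_isUnit_mem _ hi this)

end CommAlg
end LinSys

/-! ### Transcendence degree as the rank of the algebraic independence matroid. -/

namespace LinSys
noncomputable section
section AlgRank

variable {K Ω : Type*} [Field K] [Field Ω] [Algebra K Ω]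

variable (K) in
/-- The transcendence degree of the field generated by a set of elements. -/
def algRank (S : Set Ω) : ℕ∞ := (AlgebraicIndependent.matroid K Ω).eRk S

variable (K) in
/-- The elements which are algebraic over the field generated by a set. -/
def algCl (S : Set Ω) : IntermediateField K Ω :=
  ((Subalgebra.algebraicClosure (Algebra.adjoin K S) Ω).restrictScalars K).toIntermediateField
    fun _ hx => IsAlgebraic.inv hx

theorem coe_algCl (S : Set Ω) :
    (algCl K S : Set Ω) = (AlgebraicIndependent.matroid K Ω).closure S := by
  rw [AlgebraicIndependent.matroid_closure_eq]
  rfl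

theorem subset_algCl (S : Set Ω) : S ⊆ algCl K S := by
  rw [coe_algCl]
  exact Matroid.subset_closure _ _ (Set.subset_univ _)

theorem algRank_mono {S T : Set Ω} (h : S ⊆ T) : algRank K S ≤ algRank K T :=
  Matroid.eRk_mono _ h

theorem algRank_le_of_subset_algCl {S T : Set Ω} (h : S ⊆ algCl K T) :
    algRank K S ≤ algRank K T := by
  rw [coe_algCl] at h
  exact ((Matroid.eRk_mono _ h).trans_eq (Matroid.eRk_closure_eq _ _))

theorem algRank_le_encard (S : Set Ω) : algRank K S ≤ S.encard := Matroid.eRk_le_encard _ _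

/-- Submodularity for `X ∪ Z` and `Y ∪ Z`: adding `Z` does not raise the ranks of `X` and `Y`, and
the intersection contains `Z`. -/
theorem algRank_union_add_le {X Y Z : Set Ω} (hX : Z ⊆ algCl K X) (hY : Z ⊆ algCl K Y) :
    algRank K (X ∪ Y) + algRank K Z ≤ algRank K X + algRank K Y := by
  have h1 : algRank K (X ∪ Z) ≤ algRank K X :=
    algRank_le_of_subset_algCl (Set.union_subset (subset_algCl X) hX)
  have h2 : algRank K (Y ∪ Z) ≤ algRank K Y :=
    algRank_le_of_subset_algCl (Set.union_subset (subset_algCl Y) hY)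
  have h3 := (AlgebraicIndependent.matroid K Ω).eRk_inter_add_eRk_union_le (X ∪ Z) (Y ∪ Z)
  calc algRank K (X ∪ Y) + algRank K Z
      ≤ algRank K ((X ∪ Z) ∪ (Y ∪ Z)) + algRank K ((X ∪ Z) ∩ (Y ∪ Z)) := by
        gcongr
        · exact algRank_mono (Set.union_subset_union Set.subset_union_left Set.subset_union_left)
        · exact algRank_mono (Set.subset_inter Set.subset_union_right Set.subset_union_right)
    _ ≤ algRank K (X ∪ Z) + algRank K (Y ∪ Z) := by rw [add_comm]; exact h3
    _ ≤ _ := add_le_add h1 h2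

/-- Specialization does not increase the transcendence degree. -/
theorem algRank_range_le_of_specialization {ι Ω' : Type*} [Field Ω'] [Algebra K Ω'] (v : ι → Ω)
    (w : ι → Ω') (h : ∀ P : MvPolynomial ι K, MvPolynomial.aeval w P = 0 →
      MvPolynomial.aeval v P = 0) : algRank K (Set.range v) ≤ algRank K (Set.range w) := by
  obtain ⟨I, hI⟩ := (AlgebraicIndependent.matroid K Ω).exists_isBasis (Set.range v)
  rw [algRank, ← hI.encard_eq_eRk]
  choose g hg using fun x : I => hI.subset x.2
  have hvg : AlgebraicIndependent K (v ∘ g) := by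
    have : v ∘ g = ((↑) : I → Ω) := funext hg
    rw [this]
    exact hI.indep
  -- A relation among these members of `w` would specialize to one among independent members of `v`.
  have hwg : AlgebraicIndependent K (w ∘ g) := by
    rw [algebraicIndependent_iff] at hvg ⊢
    intro p hp
    refine hvg p ?_
    have := h (MvPolynomial.rename g p) (by rw [MvPolynomial.aeval_rename]; exact hp)
    rwa [MvPolynomial.aeval_rename] at this
  have hind : (AlgebraicIndependent.matroid K Ω').Indep (Set.range (w ∘ g)) :=
    AlgebraicIndependent.coe_range hwg
  have := hind.encard_le_eRk_of_subset (X := Set.range w)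
    (Set.range_comp_subset_range g w)
  refine le_trans (le_of_eq ?_) this
  rw [← Set.image_univ, hwg.injective.encard_image, Set.encard_univ, Set.encard]

theorem toENat_trdeg_adjoin (S : Set Ω) :
    Cardinal.toENat (Algebra.trdeg K (Algebra.adjoin K S)) = algRank K S := by
  apply le_antisymm
  · obtain ⟨s, hs⟩ := exists_isTranscendenceBasis K (Algebra.adjoin K S)
    rw [← hs.cardinalMk_eq_trdeg]
    have hind := hs.1.map' (f := (Algebra.adjoin K S).val) Subtype.val_injective
    have hind' : (AlgebraicIndependent.matroid K Ω).Indep (Subtype.val '' s) := by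
      have := AlgebraicIndependent.coe_range hind
      rwa [Set.range_comp, Subtype.range_coe] at this
    have h1 := hind'.encard_le_eRk_of_subset (X := algCl K S) (by
      rintro _ ⟨x, -, rfl⟩
      have : Algebra.adjoin K S ≤ (algCl K S).toSubalgebra := Algebra.adjoin_le (subset_algCl S)
      exact this x.2)
    rw [Subtype.val_injective.encard_image] at h1
    exact h1.trans (algRank_le_of_subset_algCl subset_rfl)
  · obtain ⟨I, hI⟩ := (AlgebraicIndependent.matroid K Ω).exists_isBasis S
    rw [algRank, ← hI.encard_eq_eRk]
    let f : I → Algebra.adjoin K S := fun x => ⟨x, Algebra.subset_adjoin (hI.subset x.2)⟩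
    have hf : AlgebraicIndependent K f := by
      have : AlgebraicIndependent K ((Algebra.adjoin K S).val ∘ f) := hI.indep
      exact this.of_comp _
    exact OrderHomClass.mono Cardinal.toENat hf.cardinalMk_le_trdeg

/-- The variables are algebraically independent over `A`, so they stay independent when joined to an
independent set of coefficients. -/
theorem algRank_image_union_range_X_ge {A U : Type*} [CommRing A] [Algebra K A] [Fintype U]
    (j : MvPolynomial U A →ₐ[K] Ω) (hj : Function.Injective j) (S : Set A) :
    algRank K ((fun a => j (MvPolynomial.C a)) '' S) + Fintype.card U ≤
      algRank K ((fun a => j (MvPolynomial.C a)) '' S ∪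
        Set.range fun u => j (MvPolynomial.X u)) := by
  obtain ⟨I, hI⟩ := (AlgebraicIndependent.matroid K Ω).exists_isBasis
    ((fun a => j (MvPolynomial.C a)) '' S)
  rw [algRank, ← hI.encard_eq_eRk]
  choose g hgS hg using fun x : I => hI.subset x.2
  have hgi : AlgebraicIndependent K g := by
    have h1 : AlgebraicIndependent K
        ((j.comp (IsScalarTower.toAlgHom K A (MvPolynomial U A))) ∘ g) := by
      have : (j.comp (IsScalarTower.toAlgHom K A (MvPolynomial U A))) ∘ g = ((↑) : I → Ω) :=
        funext hg
      rw [this]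
      exact hI.indep
    exact h1.of_comp _
  have hX : AlgebraicIndependent A (MvPolynomial.X : U → MvPolynomial U A) :=
    MvPolynomial.algebraicIndependent_X U A
  have hsum := (hgi.sumElim_comp hX).map' hj
  have hind : (AlgebraicIndependent.matroid K Ω).Indep _ := AlgebraicIndependent.coe_range hsum
  have hle := hind.encard_le_eRk_of_subset (X := ((fun a => j (MvPolynomial.C a)) '' S ∪
        Set.range fun u => j (MvPolynomial.X u))) (by
    rintro _ ⟨u | x, rfl⟩
    · exact Or.inr ⟨u, rfl⟩
    · exact Or.inl ⟨g x, hgS x, rfl⟩)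
  refine le_trans (le_of_eq ?_) hle
  rw [← Set.image_univ, hsum.injective.encard_image, Set.encard_univ, ENat.card_sum, add_comm,
    ENat.card_eq_coe_fintype_card, Set.encard]

/-- The dimension count: if `v` is another common zero of a generic system `s` vanishing at the
generic point `ρ`, and `J` is the set of indices where the two points agree, then the defect of `J`
is at most the total defect. -/
theorem algRank_count {I : Type*} [Fintype I] {ι : I → Type*} [∀ i, Fintype (ι i)]
    (o j : ∀ i, ι i) (ρ v s : ∀ i, ι i → Ω) (hv : ∀ i, v i (j i) = 1)
    (hsρ : ∀ i, ∑ l, s i l * ρ i l = 0) (hsv : ∀ i, ∑ l, s i l * v i l = 0)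
    (hρ : ∀ i, ρ i (o i) = 1)
    (J : Finset I) (hJ : ∀ i, i ∈ J ↔ ∀ l, v i l = v i (o i) * ρ i l) (t tJ : ℕ)
    (hr : algRank K (Set.range fun p : Σ i, ι i => ρ p.1 p.2) ≤ t)
    (hrv : algRank K (Set.range fun p : Σ i, ι i => v p.1 p.2) ≤ t)
    (hrJ : tJ ≤ algRank K ((fun p : Σ i, ι i => ρ p.1 p.2) '' {p | p.1 ∈ J}))
    (hgen : (t : ℕ∞) + Nat.card {p : Σ i, ι i // p.2 ≠ o p.1} ≤
      algRank K ((Set.range fun p : Σ i, ι i => ρ p.1 p.2) ∪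
        Set.range fun u : {p : Σ i, ι i // p.2 ≠ o p.1} => s u.1.1 u.1.2)) :
    tJ + Fintype.card I ≤ t + J.card := by
  classical
  set X := Set.range fun p : Σ i, ι i => ρ p.1 p.2 with hX
  set Y := Set.range fun p : Σ i, ι i => v p.1 p.2 with hY
  set Z := (fun p : Σ i, ι i => ρ p.1 p.2) '' {p | p.1 ∈ J} with hZ
  have hvY : ∀ i l, v i l ∈ algCl K Y := fun i l => subset_algCl Y ⟨⟨i, l⟩, rfl⟩
  have hZX : Z ⊆ algCl K X := (Set.image_subset_range _ _).trans (subset_algCl X)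
  -- For `i ∈ J` the vector `ρ i` is a rescaling of `v i`, so its entries are rational in `v` as
  -- well.
  have hZY : Z ⊆ algCl K Y := by
    rintro _ ⟨⟨i, l⟩, hi, rfl⟩
    have h1 := (hJ i).1 hi
    have h0 : v i (o i) ≠ 0 := fun h0 => by
      have := h1 (j i)
      rw [hv, h0, zero_mul] at this
      exact one_ne_zero this
    have : ρ i l = v i l / v i (o i) := by rw [h1 l, mul_div_cancel_left₀ _ h0]
    change ρ i l ∈ algCl K Y
    rw [this]
    exact div_mem (hvY _ _) (hvY _ _)
  have hex : ∀ i : {i // i ∉ J}, ∃ l, v i l ≠ v i (o i) * ρ i l := fun i => by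
    have := mt (hJ i).2 i.2
    push Not at this
    exact this
  choose m hm using hex
  have hmo : ∀ i, m i ≠ o i := fun i h => hm i (by rw [h, hρ, mul_one])
  -- For `i ∉ J` the free coefficient with index `m i` will be expressed by the others. The free
  -- coefficients that are kept form `T`.
  let g : {i // i ∉ J} → {p : Σ i, ι i // p.2 ≠ o p.1} := fun i => ⟨⟨i, m i⟩, hmo i⟩
  have hg : Function.Injective g := fun a b hab =>
    Subtype.ext (congrArg (fun u => u.1.1) hab)
  let T : Finset {p : Σ i, ι i // p.2 ≠ o p.1} := Finset.univ \ Finset.univ.image g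
  let s' : {p : Σ i, ι i // p.2 ≠ o p.1} → Ω := fun u => s u.1.1 u.1.2
  have hT : T.card + Fintype.card {i // i ∉ J} = Nat.card {p : Σ i, ι i // p.2 ≠ o p.1} := by
    rw [Nat.card_eq_fintype_card, ← Finset.card_univ (α := {p : Σ i, ι i // p.2 ≠ o p.1}),
      ← Finset.card_sdiff_add_card_eq_card (Finset.subset_univ (Finset.univ.image g)),
      Finset.card_image_of_injective _ hg, Finset.card_univ]
  have hJc : Fintype.card {i // i ∉ J} + J.card = Fintype.card I := by
    rw [Fintype.card_subtype_compl, Fintype.card_coe]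
    exact Nat.sub_add_cancel (Finset.card_le_univ J)
  have hcl : X ∪ Set.range s' ⊆ algCl K ((X ∪ Y) ∪ s' '' T) := by
    have hXc : ∀ i l, ρ i l ∈ algCl K ((X ∪ Y) ∪ s' '' T) := fun i l =>
      subset_algCl _ (Or.inl (Or.inl ⟨⟨i, l⟩, rfl⟩))
    have hYc : ∀ i l, v i l ∈ algCl K ((X ∪ Y) ∪ s' '' T) := fun i l =>
      subset_algCl _ (Or.inl (Or.inr ⟨⟨i, l⟩, rfl⟩))
    rintro _ (⟨⟨i, l⟩, rfl⟩ | ⟨u, rfl⟩)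
    · exact hXc i l
    by_cases hu : u ∈ T
    · exact subset_algCl _ (Or.inr ⟨u, hu, rfl⟩)
    obtain ⟨i, rfl⟩ : ∃ i, g i = u := by simpa [T] using hu
    -- This combination of the two equations has factor zero at `o i`, since `ρ i (o i) = 1`, and a
    -- nonzero factor at `m i`, so it can be solved for the coefficient at `m i`.
    have hsum : ∑ l, s i l * (v i l - v i (o i) * ρ i l) = 0 := by
      have : ∀ l, s i l * (v i l - v i (o i) * ρ i l) =
        s i l * v i l - v i (o i) * (s i l * ρ i l) := fun l => by ring
      simp only [this, Finset.sum_sub_distrib, ← Finset.mul_sum, hsv, hsρ, mul_zero, sub_zero]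
    rw [← Finset.add_sum_erase _ _ (Finset.mem_univ (m i))] at hsum
    have hne := sub_ne_zero.2 (hm i)
    have : s' (g i) = -(∑ l ∈ Finset.univ.erase (m i), s i l * (v i l - v i (o i) * ρ i l)) /
        (v i (m i) - v i (o i) * ρ i (m i)) := by
      rw [eq_div_iff hne]
      exact eq_neg_of_add_eq_zero_left hsum
    change s' (g i) ∈ algCl K ((X ∪ Y) ∪ s' '' T)
    rw [this]
    refine div_mem (neg_mem (sum_mem fun l hl => ?_))
      (sub_mem (hYc _ _) (mul_mem (hYc _ _) (hXc _ _)))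
    by_cases hlo : l = o i
    · rw [hlo, hρ, mul_one, sub_self, mul_zero]
      exact zero_mem _
    · refine mul_mem (subset_algCl _ (Or.inr ⟨⟨⟨i, l⟩, hlo⟩, ?_, rfl⟩))
        (sub_mem (hYc _ _) (mul_mem (hYc _ _) (hXc _ _)))
      simp only [T, Finset.coe_sdiff, Finset.coe_univ, Finset.coe_image, Set.image_univ,
        Set.mem_sdiff, Set.mem_univ, true_and, Set.mem_range, not_exists]
      intro i' h
      have h1 : i'.1 = i.1 := congrArg (fun u => u.1.1) h
      obtain rfl : i' = i := Subtype.ext h1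
      have h2 : m i' = l := by
        have := congrArg Subtype.val h
        simpa [g] using this
      exact Finset.ne_of_mem_erase hl h2.symm
  have hle : algRank K (X ∪ Set.range s') ≤ algRank K (X ∪ Y) + T.card :=
    (algRank_le_of_subset_algCl hcl).trans <|
      (Matroid.eRk_union_le_eRk_add_encard _ _ _).trans <| by
        refine add_le_add le_rfl ((Set.encard_image_le _ _).trans_eq ?_)
        exact Set.encard_coe_eq_coe_finsetCard T
  have hsub := algRank_union_add_le hZX hZY
  have h2t : algRank K (X ∪ Y) + algRank K Z ≤ (t : ℕ∞) + t := hsub.trans (add_le_add hr hrv)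
  have hfin : algRank K (X ∪ Y) ≠ ⊤ := fun h => by
    rw [h, top_add] at h2t
    exact absurd h2t (by exact_mod_cast not_le.2 (ENat.natCast_lt_top (t + t)))
  lift algRank K (X ∪ Y) to ℕ using hfin with r hr'
  -- What remains is to combine `t + N ≤ r + |T|`, `r + tJ ≤ 2t` and `|T| + |I| - |J| = N`.
  have h3 := hgen.trans hle
  have h4 := (add_le_add (le_refl (r : ℕ∞)) hrJ).trans h2t
  generalize Nat.card {p : Σ i, ι i // p.2 ≠ o p.1} = N at hT h3
  norm_cast at h3 h4
  omega

end AlgRank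
end
end LinSys

/-! ### Polynomial functions, forms and the Zariski topologies. -/

namespace LinSys
noncomputable section
section ZariskiLemmas

variable {V : Type*} [AddCommGroup V] [Module ℂ V]

theorem isClosed_zariski_iff {C : Set V} :
    IsClosed[zariski V] C ↔ ∃ S ⊆ (polyFun V : Set (V → ℂ)), C = {v | ∀ f ∈ S, f v = 0} := by
  rw [← @isOpen_compl_iff _ _ (zariski V)]
  change Cᶜᶜ ∈ _ ↔ _
  rw [compl_compl]
  rfl

theorem isClosed_zariskiProj_iff {C : Set (ℙ ℂ V)} :
    IsClosed[zariskiProj V] C ↔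
      ∃ S : Set (V → ℂ), (∀ f ∈ S, ∃ d, IsForm d f) ∧ C = {p | ∀ f ∈ S, f p.rep = 0} := by
  rw [← @isOpen_compl_iff _ _ (zariskiProj V)]
  change Cᶜᶜ ∈ _ ↔ _
  rw [compl_compl]
  rfl

theorem isOpen_form_ne_zero {d : ℕ} {f : V → ℂ} (hf : IsForm d f) :
    IsOpen[zariskiProj V] {p : ℙ ℂ V | f p.rep ≠ 0} := by
  rw [← @isClosed_compl_iff _ (zariskiProj V), isClosed_zariskiProj_iff]
  exact ⟨{f}, by simpa using ⟨d, hf⟩, by ext; simp⟩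

theorem exists_form_of_isOpen {U : Set (ℙ ℂ V)} (hU : IsOpen[zariskiProj V] U) {p : ℙ ℂ V}
    (hp : p ∈ U) : ∃ d f, IsForm d f ∧ f p.rep ≠ 0 ∧ ∀ q : ℙ ℂ V, f q.rep ≠ 0 → q ∈ U := by
  rw [← @isClosed_compl_iff _ (zariskiProj V), isClosed_zariskiProj_iff] at hU
  obtain ⟨S, hS, hUS⟩ := hU
  have hp' : ¬ ∀ f ∈ S, f p.rep = 0 := fun h => by
    have : p ∈ Uᶜ := by rw [hUS]; exact h
    exact this hp
  push Not at hp'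
  obtain ⟨f, hf, hfp⟩ := hp'
  obtain ⟨d, hd⟩ := hS f hf
  refine ⟨d, f, hd, hfp, fun q hq => ?_⟩
  by_contra hqU
  have : q ∈ Uᶜ := hqU
  rw [hUS] at this
  exact hq (this f hf)

theorem IsForm.pow {d : ℕ} {f : V → ℂ} (hf : IsForm d f) (n : ℕ) : IsForm (d * n) (f ^ n) :=
  ⟨pow_mem hf.1 n, fun c v => by rw [Pi.pow_apply, hf.2, mul_pow, ← pow_mul, Pi.pow_apply]⟩

theorem IsForm.prod {κ : Type*} (s : Finset κ) {d : κ → ℕ} {f : κ → V → ℂ}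
    (hf : ∀ r, IsForm (d r) (f r)) : IsForm (∑ r ∈ s, d r) (∏ r ∈ s, f r) :=
  ⟨prod_mem fun r _ => (hf r).1, fun c v => by
    simp only [Finset.prod_apply, (hf _).2, Finset.prod_mul_distrib, Finset.prod_pow_eq_pow_sum]⟩

theorem isForm_dual (φ : Module.Dual ℂ V) : IsForm 1 (fun v => φ v) :=
  ⟨Algebra.subset_adjoin ⟨φ, rfl⟩, fun c v => by simp⟩

/-- A form vanishes at a representative of a point iff it vanishes at any other. -/
theorem IsForm.rep_eq_zero_iff {d : ℕ} {f : V → ℂ} (hf : IsForm d f) {v : V} (hv : v ≠ 0) :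
    f (Projectivization.mk ℂ v hv).rep = 0 ↔ f v = 0 := by
  obtain ⟨c, hc⟩ := Projectivization.exists_smul_eq_mk_rep ℂ v hv
  rw [← hc, Units.smul_def, hf.2]
  simp

theorem comp_mem_of_mem_polyFun {P : Type*} (A : Subalgebra ℂ (P → ℂ)) (y : P → V)
    (hy : ∀ φ : Module.Dual ℂ V, (fun p => φ (y p)) ∈ A) {F : V → ℂ} (hF : F ∈ polyFun V) :
    (fun p => F (y p)) ∈ A := by
  induction hF using Algebra.adjoin_induction with
  | mem x hx => obtain ⟨φ, rfl⟩ := hx; exact hy φ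
  | algebraMap r => exact A.algebraMap_mem r
  | add f g _ _ hf hg => exact add_mem hf hg
  | mul f g _ _ hf hg => exact mul_mem hf hg

/-- This turns a character of an affine coordinate ring into a point, whose coordinates are the
values of the character on the coordinate functions. -/
theorem map_comp_of_mem_polyFun {P : Type*} {A : Subalgebra ℂ (P → ℂ)} (y : P → V)
    (hy : ∀ φ : Module.Dual ℂ V, (fun p => φ (y p)) ∈ A) (χ : A →ₐ[ℂ] ℂ) (w : V)
    (hw : ∀ φ : Module.Dual ℂ V, χ ⟨_, hy φ⟩ = φ w) {F : V → ℂ} (hF : F ∈ polyFun V) :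
    χ ⟨_, comp_mem_of_mem_polyFun A y hy hF⟩ = F w := by
  induction hF using Algebra.adjoin_induction with
  | mem x hx => obtain ⟨φ, rfl⟩ := hx; exact hw φ
  | algebraMap r => exact χ.commutes r
  | add f g hf' hg' hf hg =>
    rw [Pi.add_apply, ← hf, ← hg, ← map_add]
    rfl
  | mul f g hf' hg' hf hg =>
    rw [Pi.mul_apply, ← hf, ← hg, ← map_mul]
    rfl

/-- Polynomial functions can be homogenized. -/
theorem exists_homogenization (ℓ : Module.Dual ℂ V) {f : V → ℂ} (hf : f ∈ polyFun V) :
    ∃ d F, IsForm d F ∧ ∀ v, ℓ v = 1 → F v = f v := by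
  induction hf using Algebra.adjoin_induction with
  | mem x hx => obtain ⟨φ, rfl⟩ := hx; exact ⟨1, _, isForm_dual φ, fun _ _ => rfl⟩
  | algebraMap r => exact ⟨0, _, isForm_const r, fun _ _ => rfl⟩
  | add f g _ _ hf hg =>
    obtain ⟨d, F, hF, h⟩ := hf
    obtain ⟨e, G, hG, h'⟩ := hg
    -- Powers of `ℓ`, which is `1` on the hyperplane considered, bring both summands to degree `d +
    -- e`.
    refine ⟨d + 1 * e, F * (fun v => ℓ v) ^ e + (fun v => ℓ v) ^ d * G,
      (hF.mul ((isForm_dual ℓ).pow e)).add ?_, fun v hv => by simp [hv, h v hv, h' v hv]⟩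
    have := ((isForm_dual ℓ).pow d).mul hG
    rwa [one_mul] at this ⊢
  | mul f g _ _ hf hg =>
    obtain ⟨d, F, hF, h⟩ := hf
    obtain ⟨e, G, hG, h'⟩ := hg
    exact ⟨d + e, F * G, hF.mul hG, fun v hv => by simp [h v hv, h' v hv]⟩

end ZariskiLemmas

/-! ### Regular functions on an irreducible variety and affine neighbourhoods. -/

section Regular

variable {X : QuasiProjVar}

theorem QuasiProjVar.coord_ne_zero (x : X.Pt) : X.coord x ≠ 0 := Projectivization.rep_nonzero _

instance : Nonempty X.Pt := X.irreducible.1.to_subtype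

theorem QuasiProjVar.isOpen_iff {U : Set X.Pt} :
    IsOpen U ↔ ∃ t, IsOpen[zariskiProj (Fin (X.N + 1) → ℂ)] t ∧ Subtype.val ⁻¹' t = U :=
  @isOpen_induced_iff _ _ (zariskiProj (Fin (X.N + 1) → ℂ)) _ _

theorem QuasiProjVar.inter_nonempty {U W : Set X.Pt} (hU : IsOpen U) (hW : IsOpen W)
    (hU' : U.Nonempty) (hW' : W.Nonempty) : (U ∩ W).Nonempty := by
  obtain ⟨u, hu, rfl⟩ := QuasiProjVar.isOpen_iff.1 hU
  obtain ⟨w, hw, rfl⟩ := QuasiProjVar.isOpen_iff.1 hW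
  obtain ⟨x, hx⟩ := hU'
  obtain ⟨y, hy⟩ := hW'
  obtain ⟨z, hz, hzu, hzw⟩ := X.irreducible.2 u w hu hw ⟨x.1, x.2, hx⟩ ⟨y.1, y.2, hy⟩
  exact ⟨⟨z, hz⟩, hzu, hzw⟩

theorem QuasiProjVar.isOpen_form_ne_zero {d : ℕ} {f : (Fin (X.N + 1) → ℂ) → ℂ} (hf : IsForm d f) :
    IsOpen {x : X.Pt | f (X.coord x) ≠ 0} :=
  QuasiProjVar.isOpen_iff.2 ⟨_, LinSys.isOpen_form_ne_zero hf, rfl⟩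

theorem isOpen_regularFun_ne_zero {W : Set X.Pt} (hW : IsOpen W) {f : W → ℂ}
    (hf : f ∈ regularFun W) : IsOpen {x : X.Pt | ∃ h : x ∈ W, f ⟨x, h⟩ ≠ 0} := by
  rw [isOpen_iff_forall_mem_open]
  rintro x ⟨h, hx⟩
  obtain ⟨d, F, G, O, hF, hG, hO, hxO, hy⟩ := hf ⟨x, h⟩
  refine ⟨W ∩ O ∩ {x | F (X.coord x) ≠ 0}, ?_,
    (hW.inter hO).inter (QuasiProjVar.isOpen_form_ne_zero hF), ⟨h, hxO⟩, ?_⟩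
  · rintro y ⟨⟨hyW, hyO⟩, hyF⟩
    obtain ⟨h1, h2⟩ := hy ⟨y, hyW⟩ hyO
    exact ⟨hyW, by rw [h2]; exact div_ne_zero hyF h1⟩
  · obtain ⟨h1, h2⟩ := hy ⟨x, h⟩ hxO
    rw [h2] at hx
    exact (div_ne_zero_iff.1 hx).1

/-- The set where `f` does not vanish is open, so if nonempty it would meet `P` by irreducibility.
-/
theorem regularFun_eq_zero_of_dense {W P : Set X.Pt} (hW : IsOpen W) (hP : IsOpen P)
    (hne : P.Nonempty) {f : W → ℂ} (hf : f ∈ regularFun W)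
    (h : ∀ x (hx : x ∈ W), x ∈ P → f ⟨x, hx⟩ = 0) (x : W) : f x = 0 := by
  by_contra hx
  obtain ⟨y, ⟨hyW, hy⟩, hyP⟩ := QuasiProjVar.inter_nonempty (isOpen_regularFun_ne_zero hW hf) hP
    ⟨x.1, x.2, hx⟩ hne
  exact hy (h y hyW hyP)

theorem eq_zero_or_eq_zero_of_mul_regularFun {P : Set X.Pt} (hP : IsOpen P) {f g : P → ℂ}
    (hf : f ∈ regularFun P) (hg : g ∈ regularFun P) (h : f * g = 0) : f = 0 ∨ g = 0 := by
  by_contra hcon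
  rw [not_or, funext_iff, funext_iff] at hcon
  push Not at hcon
  obtain ⟨⟨x, hx⟩, y, hy⟩ := hcon
  obtain ⟨z, ⟨hz, h1⟩, _, h2⟩ := QuasiProjVar.inter_nonempty (isOpen_regularFun_ne_zero hP hf)
    (isOpen_regularFun_ne_zero hP hg) ⟨x.1, x.2, hx⟩ ⟨y.1, y.2, hy⟩
  exact mul_ne_zero h1 h2 (congrFun h ⟨z, hz⟩)

theorem isDomain_of_le_regularFun {P : Set X.Pt} (hP : IsOpen P) (hne : P.Nonempty)
    {A : Subalgebra ℂ (P → ℂ)} (hA : A ≤ regularFun P) : IsDomain A := by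
  have : Nonempty P := hne.to_subtype
  have : NoZeroDivisors A := ⟨fun {a b} h => by
    have := eq_zero_or_eq_zero_of_mul_regularFun hP (hA a.2) (hA b.2) (congrArg Subtype.val h)
    exact this.imp Subtype.ext Subtype.ext⟩
  exact NoZeroDivisors.to_isDomain A

/-- Every point of a variety has an affine neighbourhood on which given regular functions belong
to the affine coordinate ring. -/
theorem exists_affine_nbhd {O : Set X.Pt} (hO : IsOpen O) (hne : O.Nonempty) {κ : Type*}
    [Finite κ] (f : κ → O → ℂ) (hf : ∀ r, f r ∈ regularFun O) :
    ∃ (P : Set X.Pt) (hPO : P ⊆ O) (A : Subalgebra ℂ (P → ℂ)), IsOpen P ∧ P.Nonempty ∧ A.FG ∧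
      (∀ φ : A →ₐ[ℂ] ℂ, ∃ x : P, ∀ a : A, φ a = a.1 x) ∧ A ≤ regularFun P ∧
      ∀ r, (fun y : P => f r (Set.inclusion hPO y)) ∈ A := by
  cases nonempty_fintype κ
  obtain ⟨x₀, hx₀⟩ := hne
  choose d F G O' hF hG hO' hxO' hfO' using fun r => hf r ⟨x₀, hx₀⟩
  obtain ⟨U', Z', hU', hZ', hUZ⟩ := X.locallyClosed
  obtain ⟨S, hS, hZS⟩ := isClosed_zariskiProj_iff.1 hZ'
  have hOO : IsOpen (O ∩ ⋂ r, O' r) := hO.inter (isOpen_iInter_of_finite hO')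
  obtain ⟨T, hT, hTO⟩ := QuasiProjVar.isOpen_iff.1 hOO
  have hx₀T : (Subtype.val x₀ : ℙ ℂ (Fin (X.N + 1) → ℂ)) ∈ T ∩ U' := by
    refine ⟨?_, (hUZ ▸ x₀.2 : Subtype.val x₀ ∈ U' ∩ Z').1⟩
    have : x₀ ∈ O ∩ ⋂ r, O' r := ⟨hx₀, Set.mem_iInter.2 hxO'⟩
    rw [← hTO] at this
    exact this
  obtain ⟨d₀, H₀, hH₀, hH₀x, hH₀T⟩ := exists_form_of_isOpen
    (@IsOpen.inter _ (zariskiProj (Fin (X.N + 1) → ℂ)) _ _ hT hU') hx₀T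
  obtain ⟨m, hm⟩ : ∃ m, X.coord x₀ m ≠ 0 := by
    by_contra hcon
    push Not at hcon
    exact QuasiProjVar.coord_ne_zero x₀ (funext hcon)
  let ℓ : Fin (X.N + 1) → Module.Dual ℂ (Fin (X.N + 1) → ℂ) := fun n => LinearMap.proj n
  -- The factor `H₀` keeps `P` inside the required open sets, `ℓ m` allows the `m`-th coordinate to
  -- be normalized to `1`, and the `G r` are the denominators of the given functions.
  let H : (Fin (X.N + 1) → ℂ) → ℂ := H₀ * (fun v => ℓ m v) * ∏ r, G r
  have hH : IsForm (d₀ + 1 + ∑ r, d r) H :=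
    (hH₀.mul (isForm_dual (ℓ m))).mul (IsForm.prod Finset.univ hG)
  set e := d₀ + 1 + ∑ r, d r
  let P : Set X.Pt := {x | H (X.coord x) ≠ 0}
  have hHP : ∀ v, H v ≠ 0 → H₀ v ≠ 0 ∧ v m ≠ 0 ∧ ∀ r, G r v ≠ 0 := by
    intro v hv
    simp only [H, Pi.mul_apply, Finset.prod_apply] at hv
    exact ⟨left_ne_zero_of_mul (left_ne_zero_of_mul hv),
      right_ne_zero_of_mul (left_ne_zero_of_mul hv),
      fun r => Finset.prod_ne_zero_iff.1 (right_ne_zero_of_mul hv) r (Finset.mem_univ r)⟩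
  have hPO'' : P ⊆ O ∩ ⋂ r, O' r := by
    intro x hx
    rw [← hTO]
    exact (hH₀T _ (hHP _ hx).1).1
  have hPO : P ⊆ O := fun x hx => (hPO'' hx).1
  let y : P → (Fin (X.N + 1) → ℂ) := fun x => (X.coord x.1 m)⁻¹ • X.coord x.1
  have hym : ∀ x : P, y x m = 1 := fun x => by
    simp only [y, Pi.smul_apply, smul_eq_mul]
    exact inv_mul_cancel₀ (hHP _ x.2).2.1
  have hHy : ∀ x : P, H (y x) ≠ 0 := fun x => by
    simp only [y]
    rw [hH.2]
    exact mul_ne_zero (pow_ne_zero _ (inv_ne_zero (hHP _ x.2).2.1)) x.2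
  let h : P → ℂ := fun x => (H (y x))⁻¹
  let A : Subalgebra ℂ (P → ℂ) := Algebra.adjoin ℂ (insert h (Set.range fun n x => y x n))
  have hyψ : ∀ φ : Module.Dual ℂ (Fin (X.N + 1) → ℂ),
      (fun p => φ (y p)) = ∑ n, φ (Pi.single n 1) • (fun p => y p n) := by
    intro φ
    funext p
    rw [LinearMap.pi_apply_eq_sum_univ φ (y p)]
    simp [Finset.sum_apply, mul_comm, ← Pi.single_apply, Pi.single_comm]
  have hyA : ∀ φ : Module.Dual ℂ (Fin (X.N + 1) → ℂ), (fun p => φ (y p)) ∈ A := by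
    intro φ
    rw [hyψ]
    exact Subalgebra.sum_mem _ fun n _ => Subalgebra.smul_mem _
      (Algebra.subset_adjoin (show (fun p => y p n) ∈ insert h (Set.range fun n x => y x n) from
        Or.inr ⟨n, rfl⟩)) _
  have hhA : h ∈ A := Algebra.subset_adjoin (Set.mem_insert _ _)
  refine ⟨P, hPO, A, QuasiProjVar.isOpen_form_ne_zero hH, ⟨x₀, ?_⟩, ?_, ?_, ?_, ?_⟩
  · change H (X.coord x₀) ≠ 0
    simp only [H, Pi.mul_apply, Finset.prod_apply]
    exact mul_ne_zero (mul_ne_zero hH₀x hm) (Finset.prod_ne_zero_iff.2 fun r _ =>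
      (hfO' r ⟨x₀, hx₀⟩ (hxO' r)).1)
  · exact ⟨(Set.Finite.insert h (Set.finite_range fun n x => y x n)).toFinset, by simp [A]⟩
  · intro φ
    -- The values of `φ` on the coordinates define `w`. Since `1 / H` belongs to `A`, `H w` is
    -- nonzero, and the closed equations of `X` hold at `w` because they hold identically on `P`.
    let w : Fin (X.N + 1) → ℂ := fun n => φ (⟨_, hyA (ℓ n)⟩ : A)
    have hw : ∀ ψ : Module.Dual ℂ (Fin (X.N + 1) → ℂ), φ (⟨_, hyA ψ⟩ : A) = ψ w := by
      intro ψ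
      have : (⟨_, hyA ψ⟩ : A) = ∑ n, ψ (Pi.single n 1) • (⟨_, hyA (ℓ n)⟩ : A) := by
        refine Subtype.ext ?_
        rw [AddSubmonoidClass.coe_finsetSum]
        exact hyψ ψ
      rw [this, map_sum, LinearMap.pi_apply_eq_sum_univ ψ w]
      refine Finset.sum_congr rfl fun n _ => ?_
      rw [map_smul, smul_eq_mul, smul_eq_mul, mul_comm]
      congr 2
      funext i
      simp [Pi.single_apply, eq_comm]
    have hFw : ∀ {F : (Fin (X.N + 1) → ℂ) → ℂ} (hF : F ∈ polyFun _),
        φ (⟨_, comp_mem_of_mem_polyFun A y hyA hF⟩ : A) = F w :=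
      fun hF => map_comp_of_mem_polyFun y hyA φ w hw hF
    have hHw : H w * φ (⟨h, hhA⟩ : A) = 1 := by
      rw [← hFw hH.1, ← map_mul, ← map_one φ]
      congr 1
      exact Subtype.ext (funext fun x => mul_inv_cancel₀ (hHy x))
    have hHw0 : H w ≠ 0 := left_ne_zero_of_mul_eq_one hHw
    have hwm : w m = 1 := by
      rw [← map_one φ]
      exact congrArg φ (Subtype.ext (funext hym))
    have hw0 : w ≠ 0 := fun h0 => by simp [h0] at hwm
    let p := Projectivization.mk ℂ w hw0
    obtain ⟨c, hc⟩ := Projectivization.exists_smul_eq_mk_rep ℂ w hw0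
    have hHp : H p.rep ≠ 0 := mt (hH.rep_eq_zero_iff hw0).1 hHw0
    have hpX : p ∈ X.carrier := by
      rw [hUZ]
      refine ⟨(hH₀T p (hHP _ hHp).1).2, ?_⟩
      rw [hZS]
      intro t ht
      obtain ⟨e', he'⟩ := hS t ht
      rw [he'.rep_eq_zero_iff, ← hFw he'.1, ← map_zero φ]
      congr 1
      refine Subtype.ext (funext fun x => ?_)
      have hxZ : Subtype.val x.1 ∈ Z' := (hUZ ▸ x.1.2 : Subtype.val x.1 ∈ U' ∩ Z').2
      rw [hZS] at hxZ
      change t (y x) = 0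
      simp only [y]
      rw [he'.2]
      exact mul_eq_zero_of_right _ (hxZ t ht)
    let x : P := ⟨⟨p, hpX⟩, hHp⟩
    have hyx : y x = w := by
      have : X.coord x.1 = c • w := hc.symm
      simp only [y, this, Units.smul_def, Pi.smul_apply, hwm, smul_eq_mul, mul_one, smul_smul]
      rw [inv_mul_cancel₀ c.ne_zero, one_smul]
    let ev : A →ₐ[ℂ] ℂ := (Pi.evalAlgHom ℂ (fun _ : P => ℂ) x).comp A.val
    refine ⟨x, fun a => ?_⟩
    change φ a = ev a
    congr 1
    refine AlgHom.adjoin_ext ?_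
    intro a ha
    obtain rfl | ⟨n, rfl⟩ := ha
    · change φ ⟨h, hhA⟩ = (H (y x))⁻¹
      rw [hyx]
      exact eq_inv_of_mul_eq_one_right hHw
    · change w n = y x n
      rw [hyx]
  · refine Algebra.adjoin_le ?_
    have hform : IsForm e ((fun v : Fin (X.N + 1) → ℂ => ℓ m v) ^ e) := by
      simpa using (isForm_dual (ℓ m)).pow e
    rintro a (rfl | ⟨n, rfl⟩) x
    · refine ⟨e, _, H, Set.univ, hform, hH, isOpen_univ, trivial, fun z _ => ⟨z.2, ?_⟩⟩
      simp only [h, y]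
      rw [hH.2, mul_inv, inv_pow, inv_inv]
      rfl
    · refine ⟨1, _, _, Set.univ, isForm_dual (ℓ n), isForm_dual (ℓ m), isOpen_univ, trivial,
        fun z _ => ⟨(hHP _ z.2).2.1, ?_⟩⟩
      change (X.coord z.1 m)⁻¹ * X.coord z.1 n = _
      rw [mul_comm]
      rfl
  · intro r
    classical
    -- `Q / H` is the fraction `F r / G r` expanded to the denominator `H`.
    let Q : (Fin (X.N + 1) → ℂ) → ℂ :=
      F r * H₀ * (fun v => ℓ m v) * ∏ r' ∈ Finset.univ.erase r, G r'
    have hQ : Q ∈ polyFun _ := mul_mem (mul_mem (mul_mem (hF r).1 hH₀.1) (isForm_dual (ℓ m)).1)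
      (prod_mem fun r' _ => (hG r').1)
    have : (fun z : P => f r (Set.inclusion hPO z)) = (fun z => Q (y z)) * h := by
      funext z
      have hzr := (hfO' r (Set.inclusion hPO z) (Set.mem_iInter.1 (hPO'' z.2).2 r)).2
      have hcm := (hHP _ z.2).2.1
      have hy' := hHP _ (hHy z)
      rw [hzr]
      change F r (X.coord z.1) / G r (X.coord z.1) = Q (y z) * (H (y z))⁻¹
      have h1 : F r (X.coord z.1) / G r (X.coord z.1) = F r (y z) / G r (y z) := by
        simp only [y]
        rw [(hF r).2, (hG r).2, mul_div_mul_left]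
        exact pow_ne_zero _ (inv_ne_zero hcm)
      rw [h1]
      simp only [Q, H, Pi.mul_apply, Finset.prod_apply]
      rw [← Finset.mul_prod_erase _ _ (Finset.mem_univ r), ← div_eq_mul_inv,
        div_eq_div_iff (hy'.2.2 r)]
      · ring
      · exact mul_ne_zero (mul_ne_zero hy'.1 hy'.2.1) (mul_ne_zero (hy'.2.2 r)
          (Finset.prod_ne_zero_iff.2 fun r' _ => hy'.2.2 r'))
    rw [this]
    exact mul_mem (comp_mem_of_mem_polyFun A y hyA hQ) hhA

end Regular
end
end LinSys

/-! ### Quotients of sections and affine charts of a Kodaira image. -/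

namespace LinSys
noncomputable section
section Ratio

variable {X : QuasiProjVar}

namespace LinearSeries

instance (S : LinearSeries X) : FiniteDimensional ℂ S.E := S.finite

instance (S : LinearSeries X) : Module.Free ℂ S.E := Module.Free.of_divisionRing ℂ S.E

variable (S : LinearSeries X)

/-- The quotient `s / e` of two members of a linear series, as a function on the variety. -/
def ratio (s e : S.E) (x : X.Pt) : ℂ := (S.kodaira x).rep s / (S.kodaira x).rep e

theorem exists_rep_eq (x : X.Pt) (α : S.L.ι) (h : x ∈ S.L.U α) :
    ∃ c : ℂ, c ≠ 0 ∧ ∀ s : S.E, (S.kodaira x).rep s = c * s.1.1 α ⟨x, h⟩ := by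
  obtain ⟨c, hc⟩ := Projectivization.exists_smul_eq_mk_rep ℂ (S.ev x α h) (S.ev_ne_zero x α h)
  refine ⟨c, c.ne_zero, fun s => ?_⟩
  rw [S.kodaira_eq_mk x α h, ← hc]
  rfl

theorem ratio_eq (s e : S.E) (x : X.Pt) (α : S.L.ι) (h : x ∈ S.L.U α) :
    S.ratio s e x = s.1.1 α ⟨x, h⟩ / e.1.1 α ⟨x, h⟩ := by
  obtain ⟨c, hc, hs⟩ := S.exists_rep_eq x α h
  rw [ratio, hs, hs, mul_div_mul_left _ _ hc]

theorem rep_ne_zero_iff (s : S.E) (x : X.Pt) :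
    (S.kodaira x).rep s ≠ 0 ↔ ¬ S.VanishesAt s x := (S.kodaira_apply_eq_zero_iff x s).not

theorem vanishesAt_iff_ratio {s e : S.E} {x : X.Pt} (he : ¬ S.VanishesAt e x) :
    S.VanishesAt s x ↔ S.ratio s e x = 0 := by
  rw [ratio, div_eq_zero_iff, or_iff_left ((S.rep_ne_zero_iff e x).2 he),
    S.kodaira_apply_eq_zero_iff]

theorem ratio_self {e : S.E} {x : X.Pt} (he : ¬ S.VanishesAt e x) : S.ratio e e x = 1 :=
  div_self ((S.rep_ne_zero_iff e x).2 he)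

theorem ratio_mul_ratio (s : S.E) {e e' : S.E} {x : X.Pt} (he : ¬ S.VanishesAt e x) :
    S.ratio s e x * S.ratio e e' x = S.ratio s e' x := by
  have := (S.rep_ne_zero_iff e x).2 he
  rw [ratio, ratio, ratio]
  field_simp

theorem ratio_sum {ι : Type*} (t : Finset ι) (c : ι → ℂ) (b : ι → S.E) (e : S.E) (x : X.Pt) :
    S.ratio (∑ l ∈ t, c l • b l) e x = ∑ l ∈ t, c l * S.ratio (b l) e x := by
  simp only [ratio, map_sum, map_smul, smul_eq_mul, Finset.sum_div, mul_div_assoc]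

theorem isOpen_not_vanishesAt (s : S.E) : IsOpen {x | ¬ S.VanishesAt s x} := by
  rw [isOpen_iff_forall_mem_open]
  intro x hx
  obtain ⟨α, h⟩ := S.L.cover x
  refine ⟨_, ?_, isOpen_regularFun_ne_zero (S.L.isOpen_U α) (s.1.2.1 α),
    h, mt (S.L.vanishesAt_iff s.1 x α h).2 hx⟩
  rintro y ⟨hy, hy'⟩
  exact mt (S.L.vanishesAt_iff s.1 y α hy).1 hy'

theorem exists_not_vanishesAt {s : S.E} (hs : s ≠ 0) : ∃ x, ¬ S.VanishesAt s x := by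
  by_contra hcon
  push Not at hcon
  exact hs (Subtype.ext (Subtype.ext (funext fun α => funext fun x => hcon x.1 α x.2)))

theorem ratio_mem_regularFun (s e : S.E) {W : Set X.Pt} (hW : ∀ x ∈ W, ¬ S.VanishesAt e x) :
    (fun x : W => S.ratio s e x.1) ∈ regularFun W := by
  intro x
  obtain ⟨α, h⟩ := S.L.cover x.1
  obtain ⟨d, F, G, O, hF, hG, hO, hx, hFG⟩ := s.1.2.1 α ⟨x.1, h⟩
  obtain ⟨d', F', G', O', hF', hG', hO', hx', hFG'⟩ := e.1.2.1 α ⟨x.1, h⟩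
  refine ⟨d + d', F * G', G * F', O ∩ O' ∩ S.L.U α, hF.mul hG', hG.mul hF',
    (hO.inter hO').inter (S.L.isOpen_U α), ⟨⟨hx, hx'⟩, h⟩, ?_⟩
  rintro y ⟨⟨hy, hy'⟩, hyα⟩
  obtain ⟨h1, h2⟩ := hFG ⟨y.1, hyα⟩ hy
  obtain ⟨h1', h2'⟩ := hFG' ⟨y.1, hyα⟩ hy'
  have he : e.1.1 α ⟨y.1, hyα⟩ ≠ 0 := mt (S.L.vanishesAt_iff e.1 y.1 α hyα).2 (hW _ y.2)
  rw [h2'] at he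
  have hF'0 := (div_ne_zero_iff.1 he).1
  refine ⟨mul_ne_zero h1 hF'0, ?_⟩
  change S.ratio s e y.1 = _
  rw [S.ratio_eq s e y.1 α hyα, h2, h2', div_div_div_eq]
  rfl

/-- The image of a point in the affine chart of `ℙ(E*)` where the coordinate `e` is `1`. -/
def chartPt (e : S.E) (x : X.Pt) : Module.Dual ℂ S.E :=
  ((S.kodaira x).rep e)⁻¹ • (S.kodaira x).rep

theorem chartPt_apply (s e : S.E) (x : X.Pt) : S.chartPt e x s = S.ratio s e x := by
  rw [chartPt, LinearMap.smul_apply, smul_eq_mul, ratio, div_eq_mul_inv, mul_comm]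

theorem form_chartPt_ne_zero_iff {d : ℕ} {F : Module.Dual ℂ S.E → ℂ} (hF : IsForm d F) {e : S.E}
    {x : X.Pt} (he : ¬ S.VanishesAt e x) :
    F (S.chartPt e x) ≠ 0 ↔ F (S.kodaira x).rep ≠ 0 := by
  rw [chartPt, hF.2]
  have := pow_ne_zero d (inv_ne_zero ((S.rep_ne_zero_iff e x).2 he))
  rw [mul_ne_zero_iff, and_iff_right this]

/-- The algebra of functions on a subset of the variety which is generated by the quotients
of members of a linear series by one member. -/
def chartAlg {ι : Type*} (b : ι → S.E) (e : S.E) (D : Set X.Pt) : Subalgebra ℂ (D → ℂ) :=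
  Algebra.adjoin ℂ (Set.range fun l => fun x : D => S.ratio (b l) e x.1)

variable {ι : Type*} {b : ι → S.E}

theorem chartAlg_le_regularFun (e : S.E) {D : Set X.Pt} (hD : ∀ x ∈ D, ¬ S.VanishesAt e x) :
    S.chartAlg b e D ≤ regularFun D :=
  Algebra.adjoin_le (by rintro _ ⟨l, rfl⟩; exact S.ratio_mem_regularFun _ _ hD)

instance [Finite ι] (e : S.E) (D : Set X.Pt) : Algebra.FiniteType ℂ (S.chartAlg b e D) :=
  (S.chartAlg b e D).fg_iff_finiteType.1
    ⟨(Set.finite_range fun l => fun x : D => S.ratio (b l) e x.1).toFinset, by simp [chartAlg]⟩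

theorem form_mem_chartAlg [Finite ι] (hb : Submodule.span ℂ (Set.range b) = ⊤) (e : S.E)
    (D : Set X.Pt)
    {F : Module.Dual ℂ S.E → ℂ} (hF : F ∈ polyFun (Module.Dual ℂ S.E)) :
    (fun x : D => F (S.chartPt e x.1)) ∈ S.chartAlg b e D := by
  cases nonempty_fintype ι
  refine comp_mem_of_mem_polyFun _ (fun x : D => S.chartPt e x.1) (fun φ => ?_) hF
  obtain ⟨s, rfl⟩ := (Module.evalEquiv ℂ S.E).surjective φ
  obtain ⟨c, rfl⟩ : ∃ c : ι → ℂ, ∑ l, c l • b l = s := by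
    have : s ∈ Submodule.span ℂ (Set.range b) := by rw [hb]; trivial
    exact (Submodule.mem_span_range_iff_exists_fun ℂ).1 this
  have : (fun x : D => Module.evalEquiv ℂ S.E (∑ l, c l • b l) (S.chartPt e x.1)) =
      ∑ l, c l • fun x : D => S.ratio (b l) e x.1 := by
    funext x
    simp only [Module.evalEquiv_apply, Module.Dual.eval_apply, chartPt_apply, ratio_sum,
      Finset.sum_apply, Pi.smul_apply,
      smul_eq_mul]
  rw [this]
  exact Subalgebra.sum_mem _ fun l _ =>
    Subalgebra.smul_mem _ (Algebra.subset_adjoin (Set.mem_range_self l)) _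

/-- An element of the algebra is a polynomial in the coordinates of `chartPt e x`. Homogenizing by
the coordinate `e`, which is `1` there, gives the form. -/
theorem exists_form_of_mem_chartAlg (e : S.E) {D : Set X.Pt} (hD : ∀ x ∈ D, ¬ S.VanishesAt e x)
    {f : D → ℂ} (hf : f ∈ S.chartAlg b e D) :
    ∃ d F, IsForm d F ∧ ∀ x : D, f x ≠ 0 ↔ F (S.kodaira x.1).rep ≠ 0 := by
  have : ∃ q ∈ polyFun (Module.Dual ℂ S.E), ∀ x : D, f x = q (S.chartPt e x.1) := by
    induction hf using Algebra.adjoin_induction with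
    | mem f hf =>
      obtain ⟨l, rfl⟩ := hf
      exact ⟨_, (isForm_dual (Module.Dual.eval ℂ S.E (b l))).1,
        fun x => (S.chartPt_apply _ _ _).symm⟩
    | algebraMap r => exact ⟨_, Subalgebra.algebraMap_mem _ r, fun _ => rfl⟩
    | add f g _ _ hf hg =>
      obtain ⟨p, hp, hfp⟩ := hf
      obtain ⟨q, hq, hgq⟩ := hg
      exact ⟨p + q, add_mem hp hq, fun x => congrArg₂ (· + ·) (hfp x) (hgq x)⟩
    | mul f g _ _ hf hg =>
      obtain ⟨p, hp, hfp⟩ := hf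
      obtain ⟨q, hq, hgq⟩ := hg
      exact ⟨p * q, mul_mem hp hq, fun x => congrArg₂ (· * ·) (hfp x) (hgq x)⟩
  obtain ⟨q, hq, hfq⟩ := this
  obtain ⟨d, F, hF, hFq⟩ := exists_homogenization (Module.Dual.eval ℂ S.E e) hq
  refine ⟨d, F, hF, fun x => ?_⟩
  rw [← S.form_chartPt_ne_zero_iff hF (hD x.1 x.2), hfq, hFq]
  rw [Module.Dual.eval_apply, chartPt_apply, S.ratio_self (hD x.1 x.2)]

end LinearSeries

end Ratio
end
end LinSys

/-! ### The dimension of a Kodaira image as a transcendence degree. -/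

namespace LinSys
noncomputable section
section ProjDim

variable {X : QuasiProjVar}

theorem toENat_trdeg_eq_algRank {K R Ω : Type*} [Field K] [CommRing R] [Algebra K R] [Field Ω]
    [Algebra K Ω] (κ : R →ₐ[K] Ω) (hκ : Function.Injective κ) {ι : Type*} (g : ι → R)
    (hg : Algebra.adjoin K (Set.range g) = ⊤) :
    Cardinal.toENat (Algebra.trdeg K R) = algRank K (Set.range fun l => κ (g l)) := by
  have h1 : Algebra.adjoin K (Set.range fun l => κ (g l)) = κ.range := by
    rw [← Algebra.map_top, ← hg, AlgHom.map_adjoin, ← Set.range_comp]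
    rfl
  rw [← toENat_trdeg_adjoin, h1, ← Cardinal.toENat_lift,
    (AlgEquiv.ofInjective κ hκ).lift_trdeg_eq, Cardinal.toENat_lift]

variable (X) in
/-- An affine open subset of a variety, with its coordinate ring. -/
structure AffineChart where
  P : Set X.Pt
  A : Subalgebra ℂ (P → ℂ)
  isOpen : IsOpen P
  nonempty : P.Nonempty
  fg : A.FG
  exists_point : ∀ φ : A →ₐ[ℂ] ℂ, ∃ x : P, ∀ a : A, φ a = a.1 x
  le_regularFun : A ≤ regularFun P

instance (C : AffineChart X) : IsDomain C.A :=
  isDomain_of_le_regularFun C.isOpen C.nonempty C.le_regularFun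

instance (C : AffineChart X) : Algebra.FiniteType ℂ C.A :=
  C.A.fg_iff_finiteType.1 C.fg

namespace LinearSeries

variable (S : LinearSeries X) {ι : Type*} {b : ι → S.E} (C : AffineChart X)

theorem exists_not_vanishesAt_of_span (hb : Submodule.span ℂ (Set.range b) = ⊤) (x : X.Pt) :
    ∃ l, ¬ S.VanishesAt (b l) x := by
  by_contra hcon
  push Not at hcon
  have h0 : (S.kodaira x).rep = 0 := by
    refine LinearMap.ext_on_range (v := b) hb fun l => ?_
    rw [(S.kodaira_apply_eq_zero_iff x (b l)).2 (hcon l)]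
    rfl
  exact (S.kodaira x).rep_nonzero h0

/-- The coordinate ring of a standard chart of the image of a Kodaira map, embedded in a field. -/
theorem toENat_trdeg_chartAlg
    (hA : ∀ l m, (fun x : C.P => S.ratio (b l) (b m) x.1) ∈ C.A)
    {Ω : Type*} [Field Ω] [Algebra ℂ Ω] (j : C.A →ₐ[ℂ] Ω) (hj : Function.Injective j)
    (l₁ : ι) {D : Set X.Pt} (hDo : IsOpen D) (hPD : C.P ⊆ D)
    (hD : ∀ x ∈ D, ¬ S.VanishesAt (b l₁) x) :
    Cardinal.toENat (Algebra.trdeg ℂ (S.chartAlg b (b l₁) D)) =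
      algRank ℂ (Set.range fun l => j ⟨_, hA l l₁⟩) := by
  let res : (D → ℂ) →ₐ[ℂ] (C.P → ℂ) :=
    AlgHom.pi fun p : C.P => Pi.evalAlgHom ℂ (fun _ : D => ℂ) ⟨p.1, hPD p.2⟩
  have hres : ∀ f ∈ S.chartAlg b (b l₁) D, res f ∈ C.A := by
    intro f hf
    have : S.chartAlg b (b l₁) D ≤ C.A.comap res :=
      Algebra.adjoin_le (by rintro _ ⟨l, rfl⟩; exact hA l l₁)
    exact this hf
  let κ : S.chartAlg b (b l₁) D →ₐ[ℂ] C.A :=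
    (res.comp (Subalgebra.val _)).codRestrict C.A fun f => hres f.1 f.2
  -- Restriction from `D` to the chart loses nothing, because the chart is dense.
  have hκ : Function.Injective κ := by
    rw [injective_iff_map_eq_zero]
    intro f hf
    refine Subtype.ext (funext fun x => ?_)
    refine regularFun_eq_zero_of_dense hDo C.isOpen C.nonempty
      (S.chartAlg_le_regularFun _ hD f.2) (fun y hy hyP => ?_) x
    exact congrFun (congrArg Subtype.val hf) ⟨y, hyP⟩
  let g : ι → S.chartAlg b (b l₁) D := fun l => ⟨_, Algebra.subset_adjoin (Set.mem_range_self l)⟩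
  have hg : Algebra.adjoin ℂ (Set.range g) = ⊤ := by
    apply Subalgebra.map_injective (f := (S.chartAlg b (b l₁) D).val) Subtype.val_injective
    rw [AlgHom.map_adjoin, ← Set.range_comp, Algebra.map_top, Subalgebra.range_val]
    rfl
  exact toENat_trdeg_eq_algRank (j.comp κ) (hj.comp hκ) g hg

/-- Since `b l / b l₁ = (b l / b l₀) / (b l₁ / b l₀)`, a change of denominator does not enlarge the
generated field. -/
theorem algRank_ratio_le (hnv : ∀ x ∈ C.P, ∀ l, ¬ S.VanishesAt (b l) x)
    (hA : ∀ l m, (fun x : C.P => S.ratio (b l) (b m) x.1) ∈ C.A)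
    {Ω : Type*} [Field Ω] [Algebra ℂ Ω] (j : C.A →ₐ[ℂ] Ω) (l₀ l₁ : ι) :
    algRank ℂ (Set.range fun l => j ⟨_, hA l l₁⟩) ≤
      algRank ℂ (Set.range fun l => j ⟨_, hA l l₀⟩) := by
  apply algRank_le_of_subset_algCl
  rintro _ ⟨l, rfl⟩
  have hmul : ∀ l l' l'', j ⟨_, hA l l'⟩ * j ⟨_, hA l' l''⟩ = j ⟨_, hA l l''⟩ := by
    intro l l' l''
    rw [← map_mul]
    congr 1
    exact Subtype.ext (funext fun x => S.ratio_mul_ratio _ (hnv x.1 x.2 _))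
  have hone : j ⟨_, hA l₁ l₁⟩ = 1 := by
    rw [← map_one j]
    congr 1
    exact Subtype.ext (funext fun x => S.ratio_self (hnv x.1 x.2 _))
  have h1 := hmul l₁ l₀ l₁
  rw [hone] at h1
  have h2 : j ⟨_, hA l l₁⟩ = j ⟨_, hA l l₀⟩ / j ⟨_, hA l₁ l₀⟩ := by
    rw [eq_div_iff (left_ne_zero_of_mul_eq_one h1), hmul]
  change j ⟨_, hA l l₁⟩ ∈ _
  rw [h2]
  exact div_mem (subset_algCl _ ⟨l, rfl⟩) (subset_algCl _ ⟨l₁, rfl⟩)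

-- All members of the chain meet an affine chart around a point of the smallest one. Their vanishing
-- ideals in the ring of this chart are primes and form a strict chain in reverse order, so the
-- Krull dimension of the ring bounds the length.
attribute [local instance] zariskiProj in
theorem length_le_of_irreducibleCloseds [Finite ι]
    (hb : Submodule.span ℂ (Set.range b) = ⊤)
    (l : LTSeries (TopologicalSpace.IrreducibleCloseds (Set.range S.kodaira))) :
    ∃ l₁, (l.length : ℕ∞) ≤ Cardinal.toENat
      (Algebra.trdeg ℂ (S.chartAlg b (b l₁) {x | ¬ S.VanishesAt (b l₁) x})) := by
  obtain ⟨⟨_, x₀, rfl⟩, hx₀⟩ := (l 0).isIrreducible.1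
  obtain ⟨l₁, hl₁⟩ := S.exists_not_vanishesAt_of_span hb x₀
  refine ⟨l₁, ?_⟩
  set D : Set X.Pt := {x | ¬ S.VanishesAt (b l₁) x} with hDdef
  have hD : ∀ x ∈ D, ¬ S.VanishesAt (b l₁) x := fun x hx => hx
  have hDo : IsOpen D := S.isOpen_not_vanishesAt (b l₁)
  let R := S.chartAlg b (b l₁) D
  have hdom : IsDomain R := isDomain_of_le_regularFun hDo ⟨x₀, hl₁⟩
    (S.chartAlg_le_regularFun _ hD)
  have hopen : ∀ {d F}, IsForm d F →
      IsOpen {y : Set.range S.kodaira | F y.1.rep ≠ 0} := fun hF =>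
    (isOpen_form_ne_zero hF).preimage continuous_subtype_val
  have hDopen : IsOpen {y : Set.range S.kodaira | y.1.rep (b l₁) ≠ 0} :=
    hopen (isForm_dual (Module.Dual.eval ℂ S.E (b l₁)))
  have hx₀l : ∀ i, (⟨_, x₀, rfl⟩ : Set.range S.kodaira) ∈ (l i : Set (Set.range S.kodaira)) :=
    fun i => (l.monotone (Fin.zero_le i) : (l 0 : Set (Set.range S.kodaira)) ⊆ l i) hx₀
  -- nonvanishing of a form somewhere on an irreducible closed set implies nonvanishing on a point
  -- of the chart
  have key : ∀ i {u : Set (Set.range S.kodaira)}, IsOpen u →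
      ((l i : Set (Set.range S.kodaira)) ∩ u).Nonempty →
      ((l i : Set (Set.range S.kodaira)) ∩ ({y | y.1.rep (b l₁) ≠ 0} ∩ u)).Nonempty :=
    fun i u hu hne => (l i).isIrreducible.2 _ _ hDopen hu
      ⟨_, hx₀l i, (S.rep_ne_zero_iff _ _).2 hl₁⟩ hne
  let I : Fin (l.length + 1) → Ideal R := fun i =>
    { carrier := {f | ∀ x : D, (⟨_, x.1, rfl⟩ : Set.range S.kodaira) ∈
        (l i : Set (Set.range S.kodaira)) → f.1 x = 0}
      add_mem' := fun {f g} hf hg x hx => by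
        change f.1 x + g.1 x = 0
        rw [hf x hx, hg x hx, add_zero]
      zero_mem' := fun _ _ => rfl
      smul_mem' := fun c f hf x hx => by
        change c.1 x * f.1 x = 0
        rw [hf x hx, mul_zero] }
  have hprime : ∀ i, (I i).IsPrime := by
    intro i
    refine ⟨fun h => ?_, fun {f g} hfg => ?_⟩
    · have : (1 : R) ∈ I i := h ▸ Submodule.mem_top
      exact one_ne_zero (this ⟨x₀, hl₁⟩ (hx₀l i))
    · by_contra hcon
      rw [not_or] at hcon
      obtain ⟨hf, hg⟩ := hcon
      obtain ⟨d, F, hF, hfF⟩ := S.exists_form_of_mem_chartAlg _ hD f.2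
      obtain ⟨e, G, hG, hgG⟩ := S.exists_form_of_mem_chartAlg _ hD g.2
      have h1 : ∀ (f : R) (F : Module.Dual ℂ S.E → ℂ),
          (∀ x : D, f.1 x ≠ 0 ↔ F (S.kodaira x.1).rep ≠ 0) → f ∉ I i →
          ((l i : Set (Set.range S.kodaira)) ∩ {y | F y.1.rep ≠ 0}).Nonempty := by
        intro f F hfF hf
        have : ∃ x : D, (⟨_, x.1, rfl⟩ : Set.range S.kodaira) ∈
            (l i : Set (Set.range S.kodaira)) ∧ f.1 x ≠ 0 := by
          by_contra hno
          push Not at hno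
          exact hf hno
        obtain ⟨x, hx, hfx⟩ := this
        exact ⟨_, hx, (hfF x).1 hfx⟩
      have h2 := (l i).isIrreducible.2 _ _ (hopen hF) (hopen hG) (h1 f F hfF hf) (h1 g G hgG hg)
      obtain ⟨⟨_, x, rfl⟩, hx, hxD, hxF, hxG⟩ := key i ((hopen hF).inter (hopen hG)) h2
      have hxD' : x ∈ D := (S.rep_ne_zero_iff _ _).1 hxD
      exact mul_ne_zero ((hfF ⟨x, hxD'⟩).2 hxF) ((hgG ⟨x, hxD'⟩).2 hxG) (hfg ⟨x, hxD'⟩ hx)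
  let L : LTSeries (PrimeSpectrum R)ᵒᵈ :=
    { length := l.length
      toFun := fun i => OrderDual.toDual ⟨I i, hprime i⟩
      step := fun i => by
        have hlt : l i.castSucc < l i.succ := l.step i
        change I i.succ < I i.castSucc
        have hle : (l i.castSucc : Set (Set.range S.kodaira)) ⊆ l i.succ := hlt.le
        refine lt_of_le_not_ge (fun f hf x hx => hf x (hle hx)) fun hge => ?_
        obtain ⟨y, hy, hy'⟩ : ∃ y ∈ (l i.succ : Set (Set.range S.kodaira)), y ∉ l i.castSucc := by
          by_contra hno
          push Not at hno
          exact hlt.not_ge hno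
        obtain ⟨u, hu, hul⟩ := isOpen_induced_iff.1 (l i.castSucc).isClosed.isOpen_compl
        have hyu : y.1 ∈ u := by
          have : y ∈ Subtype.val ⁻¹' u := by rw [hul]; exact hy'
          exact this
        obtain ⟨d, F, hF, hFy, hFu⟩ := exists_form_of_isOpen hu hyu
        obtain ⟨⟨_, x, rfl⟩, hx, hxD, hxF⟩ := key i.succ (hopen hF) ⟨y, hy, hFy⟩
        have hxD' : x ∈ D := (S.rep_ne_zero_iff _ _).1 hxD
        let f : R := ⟨_, S.form_mem_chartAlg hb (b l₁) D hF.1⟩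
        have hf : f ∈ I i.castSucc := by
          intro z hz
          by_contra hne
          have h1 : F (S.kodaira z.1).rep ≠ 0 := (S.form_chartPt_ne_zero_iff hF z.2).1 hne
          have h2 : (⟨_, z.1, rfl⟩ : Set.range S.kodaira) ∈ Subtype.val ⁻¹' u := hFu _ h1
          rw [hul] at h2
          exact h2 hz
        have h3 := hge hf ⟨x, hxD'⟩ hx
        exact (S.form_chartPt_ne_zero_iff hF hxD').2 hxF h3 }
  have h1 : (L.length : WithBot ℕ∞) ≤ ringKrullDim R := by
    rw [ringKrullDim, ← Order.krullDim_orderDual]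
    exact Order.LTSeries.length_le_krullDim L
  rw [ringKrullDim_eq_trdeg ℂ R] at h1
  exact_mod_cast h1

-- By `exists_extension` every closed point of the spectrum of `R` outside a hypersurface `a = 0`
-- comes from a point of `C.P`. A chain of primes avoiding `a` therefore gives sets of image points
-- whose closures are irreducible and strictly nested.
attribute [local instance] zariskiProj in
theorem le_krullDim_range_kodaira [Finite ι]
    (hb : Submodule.span ℂ (Set.range b) = ⊤)
    (hnv : ∀ x ∈ C.P, ∀ l, ¬ S.VanishesAt (b l) x)
    (hA : ∀ l m, (fun x : C.P => S.ratio (b l) (b m) x.1) ∈ C.A) (l₀ : ι) (n : ℕ)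
    (hn : (n : ℕ∞) ≤ Cardinal.toENat (Algebra.trdeg ℂ (S.chartAlg b (b l₀) C.P))) :
    (n : WithBot ℕ∞) ≤ topologicalKrullDim (Set.range S.kodaira) := by
  let Y := Set.range S.kodaira
  let R := S.chartAlg b (b l₀) C.P
  have hnv₀ : ∀ x ∈ C.P, ¬ S.VanishesAt (b l₀) x := fun x hx => hnv x hx l₀
  have hle : R ≤ C.A := Algebra.adjoin_le (by rintro _ ⟨l, rfl⟩; exact hA l l₀)
  have hdom : IsDomain R := isDomain_of_le_regularFun C.isOpen C.nonempty
    (hle.trans C.le_regularFun)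
  obtain ⟨a, ha, hext⟩ := exists_extension (K := ℂ) (Subalgebra.inclusion hle)
  have ha0 : a ≠ 0 := fun h => ha (by rw [h, map_zero])
  obtain ⟨l, hl, hal⟩ := exists_ltSeries_notMem ℂ R a ha0 n hn
  have hpt : ∀ (p : Ideal R) [p.IsPrime], a ∉ p → ∀ f ∉ p,
      ∃ x : C.P, a.1 x ≠ 0 ∧ f.1 x ≠ 0 ∧ ∀ g ∈ p, g.1 x = 0 := by
    intro p hp hap f hf
    obtain ⟨φ, hφ, hφf⟩ := exists_algHom_prime (K := ℂ) p (f * a) fun h =>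
      (hp.mem_or_mem h).elim hf hap
    rw [map_mul] at hφf
    obtain ⟨ψ, hψ⟩ := hext φ (fun c hc => by
      have : c = 0 := Subalgebra.inclusion_injective hle (hc.trans (map_zero _).symm)
      rw [this, map_zero]) (right_ne_zero_of_mul hφf)
    obtain ⟨x, hx⟩ := C.exists_point ψ
    have hev : ∀ c : R, φ c = c.1 x := fun c => by rw [← hψ, hx]; rfl
    refine ⟨x, ?_, ?_, fun g hg => ?_⟩
    · rw [← hev]; exact right_ne_zero_of_mul hφf
    · rw [← hev]; exact left_ne_zero_of_mul hφf
    · rw [← hev]; exact hφ g hg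
  let V : Fin (l.length + 1) → Set Y := fun i =>
    {y | ∃ x : C.P, y.1 = S.kodaira x.1 ∧ a.1 x ≠ 0 ∧ ∀ f ∈ (l i).asIdeal, f.1 x = 0}
  have hVirr : ∀ i, IsIrreducible (V i) := by
    intro i
    constructor
    · obtain ⟨x, h1, -, h2⟩ := hpt (l i).asIdeal (hal i) 1
        (fun h => (l i).2.ne_top ((Ideal.eq_top_iff_one _).2 h))
      exact ⟨⟨_, x.1, rfl⟩, x, rfl, h1, h2⟩
    · have h1 : ∀ u : Set Y, IsOpen u → (V i ∩ u).Nonempty → ∃ f : R, f ∉ (l i).asIdeal ∧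
          ∀ x : C.P, f.1 x ≠ 0 → (⟨_, x.1, rfl⟩ : Y) ∈ u := by
        rintro u hu ⟨⟨_, hy⟩, ⟨x, rfl, hax, hx⟩, hyu⟩
        obtain ⟨t, ht, rfl⟩ := isOpen_induced_iff.1 hu
        obtain ⟨d, F, hF, hFx, hFt⟩ := exists_form_of_isOpen ht hyu
        refine ⟨⟨_, S.form_mem_chartAlg hb (b l₀) C.P hF.1⟩, fun hmem => ?_, fun z hz => ?_⟩
        · exact (S.form_chartPt_ne_zero_iff hF (hnv₀ _ x.2)).2 hFx (hx _ hmem)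
        · exact hFt _ ((S.form_chartPt_ne_zero_iff hF (hnv₀ _ z.2)).1 hz)
      intro u v hu hv hVu hVv
      obtain ⟨f, hf, hfu⟩ := h1 u hu hVu
      obtain ⟨g, hg, hgv⟩ := h1 v hv hVv
      obtain ⟨x, hax, hfg, hx⟩ := hpt (l i).asIdeal (hal i) (f * g) fun h =>
        ((l i).2.mem_or_mem h).elim hf hg
      exact ⟨⟨_, x.1, rfl⟩, ⟨x, rfl, hax, hx⟩, hfu x (left_ne_zero_of_mul hfg),
        hgv x (right_ne_zero_of_mul hfg)⟩
  let L : LTSeries (TopologicalSpace.IrreducibleCloseds Y)ᵒᵈ :=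
    { length := l.length
      toFun := fun i => OrderDual.toDual ⟨closure (V i), (hVirr i).closure, isClosed_closure⟩
      step := fun i => by
        have hlt : (l i.castSucc).asIdeal < (l i.succ).asIdeal := l.step i
        change closure (V i.succ) < closure (V i.castSucc)
        refine lt_of_le_not_ge (closure_mono ?_) fun hge => ?_
        · rintro y ⟨x, hyx, hax, hx⟩
          exact ⟨x, hyx, hax, fun f hf => hx f (hlt.le hf)⟩
        obtain ⟨f, hf, hf'⟩ := SetLike.exists_of_lt hlt
        obtain ⟨x, hax, hfx, hx⟩ := hpt (l i.castSucc).asIdeal (hal _) f hf'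
        have hmem : (⟨_, x.1, rfl⟩ : Y) ∈ closure (V i.succ) :=
          hge (subset_closure ⟨x, rfl, hax, hx⟩)
        obtain ⟨d, F, hF, hfF⟩ := S.exists_form_of_mem_chartAlg _ hnv₀ f.2
        have ho : IsOpen {y : Y | F y.1.rep ≠ 0} :=
          (isOpen_form_ne_zero hF).preimage continuous_subtype_val
        obtain ⟨⟨_, hy⟩, hyF, z, rfl, haz, hz⟩ := mem_closure_iff.1 hmem _ ho ((hfF x).1 hfx)
        exact (hfF z).2 hyF (hz f hf) }
  rw [topologicalKrullDim, ← Order.krullDim_orderDual, ← hl]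
  exact Order.LTSeries.length_le_krullDim L

/-- The dimension of the image of a Kodaira map is the transcendence degree of the field generated
by the quotients of the members of the linear series. -/
theorem projDim_range_kodaira [Finite ι]
    (hb : Submodule.span ℂ (Set.range b) = ⊤)
    (hnv : ∀ x ∈ C.P, ∀ l, ¬ S.VanishesAt (b l) x)
    (hA : ∀ l m, (fun x : C.P => S.ratio (b l) (b m) x.1) ∈ C.A)
    {Ω : Type*} [Field Ω] [Algebra ℂ Ω] (j : C.A →ₐ[ℂ] Ω) (hj : Function.Injective j) (l₀ : ι) :
    (projDim (Set.range S.kodaira) : ℕ∞) = algRank ℂ (Set.range fun l => j ⟨_, hA l l₀⟩) := by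
  let τ : TopologicalSpace (ℙ ℂ (Module.Dual ℂ S.E)) := zariskiProj (Module.Dual ℂ S.E)
  have hfin : algRank ℂ (Set.range fun l => j ⟨_, hA l l₀⟩) ≠ ⊤ := fun h => by
    have := algRank_le_encard (K := ℂ) (Set.range fun l => j ⟨_, hA l l₀⟩)
    rw [h, top_le_iff, Set.encard_eq_top_iff] at this
    exact this (Set.finite_range _)
  obtain ⟨r, hr⟩ := ENat.ne_top_iff_exists.1 hfin
  have hdim : topologicalKrullDim (Set.range S.kodaira) = r := by
    apply le_antisymm
    · refine iSup_le fun l => ?_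
      obtain ⟨l₁, hl₁⟩ := S.length_le_of_irreducibleCloseds hb l
      rw [S.toENat_trdeg_chartAlg C hA j hj l₁ (S.isOpen_not_vanishesAt _)
        (fun x hx => hnv x hx l₁) fun x hx => hx] at hl₁
      have := hl₁.trans (S.algRank_ratio_le C hnv hA j l₀ l₁)
      rw [← hr] at this
      exact_mod_cast this
    · refine S.le_krullDim_range_kodaira C hb hnv hA l₀ r ?_
      rw [S.toENat_trdeg_chartAlg C hA j hj l₀ C.isOpen subset_rfl fun x hx => hnv x hx l₀,
        ← hr]
  rw [← hr, projDim]
  change (((topologicalKrullDim (Set.range S.kodaira)).unbotD 0).toNat : ℕ∞) = r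
  rw [hdim]
  rfl

end LinearSeries
end ProjDim
end
end LinSys

/-! ### Products of linear series and the numbers τ_J. -/

namespace LinSys
noncomputable section
section Products

variable {X : QuasiProjVar}

namespace LinearSeries

theorem kodaira_eq_of_ratio_eq (S : LinearSeries X) {ι : Type*} {b : ι → S.E}
    (hb : Submodule.span ℂ (Set.range b) = ⊤) {x x' : X.Pt} {e : S.E}
    (he : ¬ S.VanishesAt e x) (he' : ¬ S.VanishesAt e x')
    (h : ∀ l, S.ratio (b l) e x = S.ratio (b l) e x') : S.kodaira x = S.kodaira x' := by
  have h1 := (S.rep_ne_zero_iff e x).2 he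
  have h2 := (S.rep_ne_zero_iff e x').2 he'
  rw [← Projectivization.mk_rep (S.kodaira x), ← Projectivization.mk_rep (S.kodaira x'),
    Projectivization.mk_eq_mk_iff']
  refine ⟨(S.kodaira x).rep e / (S.kodaira x').rep e,
    LinearMap.ext_on_range (v := b) hb fun l => ?_⟩
  have h3 := h l
  rw [ratio, ratio, div_eq_div_iff h1 h2] at h3
  rw [LinearMap.smul_apply, smul_eq_mul, div_mul_eq_mul_div, div_eq_iff h2, h3, mul_comm]

variable {κ : Type} [Fintype κ] (S : κ → LinearSeries X)

/-- The product of members of linear series, as a member of their product. -/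
def prodMem (s : ∀ j, (S j).E) : (prod S).E :=
  ⟨LineBundle.tensorSection (fun j => (S j).L) fun j => (s j).1,
    show LineBundle.tensorSection (fun j => (S j).L) (fun j => (s j).1) ∈ Submodule.span ℂ {σ |
      ∃ s : ∀ j, (S j).L.sections, (∀ j, s j ∈ (S j).E) ∧
        σ = LineBundle.tensorSection (fun j => (S j).L) s} from
      Submodule.subset_span ⟨fun j => (s j).1, fun j => (s j).2, rfl⟩⟩

theorem prodMem_apply (s : ∀ j, (S j).E) (x : X.Pt) (a : ∀ j, (S j).L.ι)
    (h : ∀ j, x ∈ (S j).L.U (a j)) :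
    (prodMem S s).1.1 a ⟨x, Set.mem_iInter.2 h⟩ = ∏ j, (s j).1.1 (a j) ⟨x, h j⟩ := rfl

theorem vanishesAt_prodMem_iff (s : ∀ j, (S j).E) (x : X.Pt) :
    (prod S).VanishesAt (prodMem S s) x ↔ ∃ j, (S j).VanishesAt (s j) x := by
  choose a ha using fun j => (S j).L.cover x
  rw [VanishesAt, LineBundle.vanishesAt_iff _ _ x a (Set.mem_iInter.2 ha)]
  rw [show (prodMem S s).1.1 a ⟨x, Set.mem_iInter.2 ha⟩ = _ from prodMem_apply S s x a ha,
    Finset.prod_eq_zero_iff]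
  simp only [Finset.mem_univ, true_and]
  exact exists_congr fun j => ((S j).L.vanishesAt_iff (s j).1 x (a j) (ha j)).symm

theorem ratio_prodMem (s e : ∀ j, (S j).E) (x : X.Pt) :
    (prod S).ratio (prodMem S s) (prodMem S e) x = ∏ j, (S j).ratio (s j) (e j) x := by
  choose a ha using fun j => (S j).L.cover x
  rw [(prod S).ratio_eq _ _ x a (Set.mem_iInter.2 ha)]
  rw [show (prodMem S s).1.1 a ⟨x, Set.mem_iInter.2 ha⟩ = _ from prodMem_apply S s x a ha,
    show (prodMem S e).1.1 a ⟨x, Set.mem_iInter.2 ha⟩ = _ from prodMem_apply S e x a ha,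
    ← Finset.prod_div_distrib]
  exact Finset.prod_congr rfl fun j _ => ((S j).ratio_eq _ _ x (a j) (ha j)).symm

/-- Multilinearity expands a product of arbitrary members into products of members of the spanning
families. -/
theorem span_range_prodMem {ι : κ → Type*} [∀ j, Finite (ι j)] {b : ∀ j, ι j → (S j).E}
    (hb : ∀ j, Submodule.span ℂ (Set.range (b j)) = ⊤) :
    Submodule.span ℂ (Set.range fun l : ∀ j, ι j => prodMem S fun j => b j (l j)) = ⊤ := by
  classical
  have : ∀ j, Fintype (ι j) := fun j => Fintype.ofFinite _
  apply Submodule.map_injective_of_injective (prod S).E.injective_subtype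
  rw [Submodule.map_span, ← Set.range_comp, Submodule.map_top, Submodule.range_subtype]
  apply le_antisymm
  · rw [Submodule.span_le]
    rintro _ ⟨l, rfl⟩
    exact (prodMem S fun j => b j (l j)).2
  · have key : Submodule.span ℂ {σ | ∃ s : ∀ j, (S j).L.sections, (∀ j, s j ∈ (S j).E) ∧
        σ = LineBundle.tensorSection (fun j => (S j).L) s} ≤
        Submodule.span ℂ (Set.range fun l : ∀ j, ι j =>
          LineBundle.tensorSection (fun j => (S j).L) fun j => (b j (l j)).1) := by
      rw [Submodule.span_le]
      rintro _ ⟨s, hs, rfl⟩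
      have hc : ∀ j, ∃ c : ι j → ℂ, ∑ l, c l • b j l = (⟨s j, hs j⟩ : (S j).E) := fun j => by
        have : (⟨s j, hs j⟩ : (S j).E) ∈ Submodule.span ℂ (Set.range (b j)) := by
          rw [hb]; trivial
        exact (Submodule.mem_span_range_iff_exists_fun ℂ).1 this
      choose c hc using hc
      have hs' : s = fun j => ∑ l, c j l • (b j l).1 := funext fun j => by
        have := congrArg Subtype.val (hc j)
        rw [AddSubmonoidClass.coe_finsetSum] at this
        exact this.symm
      change LineBundle.tensorMultilinear (fun j => (S j).L) s ∈ _
      rw [hs', MultilinearMap.map_sum]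
      refine Submodule.sum_mem _ fun l _ => ?_
      rw [MultilinearMap.map_smul_univ]
      exact Submodule.smul_mem _ _ (Submodule.subset_span ⟨l, rfl⟩)
    exact key

/-- Take `e i` nonvanishing at `x`. Their product does not vanish at `x`, hence not at `x'`. With `e
j` replaced by `s` the product vanishes at `x`, hence at `x'`, and only the factor `s` can be
responsible. -/
theorem vanishesAt_of_kodaira_prod_eq {x x' : X.Pt}
    (h : (prod S).kodaira x = (prod S).kodaira x') (j : κ) (s : (S j).E)
    (hs : (S j).VanishesAt s x) : (S j).VanishesAt s x' := by
  classical
  have hiff : ∀ t, (prod S).VanishesAt t x ↔ (prod S).VanishesAt t x' := fun t => by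
    rw [← kodaira_apply_eq_zero_iff, ← kodaira_apply_eq_zero_iff, h]
  have hex : ∀ j, ∃ e : (S j).E, ¬ (S j).VanishesAt e x := fun j => by
    obtain ⟨e, he, hx⟩ := (S j).basePointFree x
    exact ⟨⟨e, he⟩, hx⟩
  choose e he using hex
  have h1 : ∀ i, ¬ (S i).VanishesAt (e i) x' := by
    have : ¬ (prod S).VanishesAt (prodMem S e) x' := by
      rw [← hiff, vanishesAt_prodMem_iff]
      exact fun ⟨j, hj⟩ => he j hj
    rw [vanishesAt_prodMem_iff] at this
    exact fun i hi => this ⟨i, hi⟩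
  have h2 : (prod S).VanishesAt (prodMem S (Function.update e j s)) x' := by
    rw [← hiff, vanishesAt_prodMem_iff]
    exact ⟨j, by rwa [Function.update_self]⟩
  rw [vanishesAt_prodMem_iff] at h2
  obtain ⟨i, hi⟩ := h2
  by_cases hij : i = j
  · subst hij
    rwa [Function.update_self] at hi
  · rw [Function.update_of_ne hij] at hi
    exact absurd hi (h1 i)

end LinearSeries

/-- The quotients for `E_J` are products of quotients of the single series. Conversely a single
quotient is the product in which all other numerators are the distinguished members. So both
families generate the same field. -/
theorem tau_eq_algRank {k : ℕ} (E : Fin k → LinearSeries X) {ι : Fin k → Type*}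
    [∀ i, Finite (ι i)] {b : ∀ i, ι i → (E i).E}
    (hb : ∀ i, Submodule.span ℂ (Set.range (b i)) = ⊤) (C : AffineChart X)
    (hnv : ∀ x ∈ C.P, ∀ i l, ¬ (E i).VanishesAt (b i l) x)
    (hA : ∀ i l m, (fun x : C.P => (E i).ratio (b i l) (b i m) x.1) ∈ C.A)
    {Ω : Type*} [Field Ω] [Algebra ℂ Ω] (j : C.A →ₐ[ℂ] Ω) (hj : Function.Injective j)
    (o : ∀ i, ι i) (J : Finset (Fin k)) :
    (tau E J : ℕ∞) =
      algRank ℂ ((fun p : Σ i, ι i => j ⟨_, hA p.1 p.2 (o p.1)⟩) '' {p | p.1 ∈ J}) := by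
  classical
  let S : J → LinearSeries X := fun i => E i
  let c : (∀ i : J, ι i) → (LinearSeries.prod S).E := fun l =>
    LinearSeries.prodMem S fun i => b i (l i)
  have hcA' : ∀ l m, (fun x : C.P => (LinearSeries.prod S).ratio (c l) (c m) x.1) =
      ∏ i : J, fun x : C.P => (E i).ratio (b i (l i)) (b i (m i)) x.1 := fun l m => by
    funext x
    rw [Finset.prod_apply]
    exact LinearSeries.ratio_prodMem S _ _ x.1
  have hcA : ∀ l m, (fun x : C.P => (LinearSeries.prod S).ratio (c l) (c m) x.1) ∈ C.A := by
    intro l m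
    rw [hcA']
    exact prod_mem fun i _ => hA _ _ _
  have hprod : ∀ l, j ⟨_, hcA l fun i => o i⟩ = ∏ i : J, j ⟨_, hA i (l i) (o i)⟩ := by
    intro l
    rw [← map_prod]
    congr 1
    refine Subtype.ext ?_
    rw [SubmonoidClass.coe_finsetProd]
    exact hcA' _ _
  have hmain := (LinearSeries.prod S).projDim_range_kodaira C (b := c)
    (LinearSeries.span_range_prodMem S fun i => hb i)
    (fun x hx l => by
      rw [LinearSeries.vanishesAt_prodMem_iff]
      exact fun ⟨i, hi⟩ => hnv x hx i (l i) hi)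
    hcA j hj fun i => o i
  change (projDim (Set.range (LinearSeries.prod S).kodaira) : ℕ∞) = _
  rw [hmain]
  apply le_antisymm
  · apply algRank_le_of_subset_algCl
    rintro _ ⟨l, rfl⟩
    change j ⟨_, hcA l fun i => o i⟩ ∈ _
    rw [hprod]
    exact prod_mem fun i _ => subset_algCl _ ⟨⟨i, l i⟩, i.2, rfl⟩
  · apply algRank_le_of_subset_algCl
    rintro _ ⟨⟨i, l⟩, hi, rfl⟩
    refine subset_algCl _ ⟨Function.update (fun i : J => o i) ⟨i, hi⟩ l, ?_⟩
    change j ⟨_, hcA _ fun i => o i⟩ = j ⟨_, hA i l (o i)⟩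
    rw [hprod, Finset.prod_eq_single (⟨i, hi⟩ : J)]
    · congr 1
      simp only [Function.update_self]
    · intro i' _ hne
      rw [← map_one j]
      congr 1
      refine Subtype.ext (funext fun x => ?_)
      simp only [Function.update_of_ne hne]
      exact (E i').ratio_self (hnv x.1 x.2 _ _)
    · exact fun h => absurd (Finset.mem_univ _) h

end Products
end
end LinSys

/-! ### The incidence variety over an affine chart and the ideal of the consistency variety. -/

namespace LinSys
noncomputable section
section Generic

variable {X : QuasiProjVar}

theorem aeval_fun_apply {ι P : Type*} (v : ι → P → ℂ) (q : MvPolynomial ι ℂ) (x : P) :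
    MvPolynomial.aeval v q x = MvPolynomial.aeval (fun l => v l x) q := by
  have : (Pi.evalAlgHom ℂ (fun _ : P => ℂ) x).comp (MvPolynomial.aeval v) =
      MvPolynomial.aeval (fun l => v l x) := MvPolynomial.algHom_ext fun l => by simp
  exact DFunLike.congr_fun this q

theorem QuasiProjVar.iInter_nonempty {κ : Type*} [Finite κ] {U : κ → Set X.Pt}
    (hU : ∀ r, IsOpen (U r)) (hne : ∀ r, (U r).Nonempty) : (⋂ r, U r).Nonempty := by
  classical
  cases nonempty_fintype κ
  have : ∀ s : Finset κ, (⋂ r ∈ s, U r).Nonempty := by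
    intro s
    induction s using Finset.induction_on with
    | empty => simp
    | insert r s hr ih =>
      rw [Finset.set_biInter_insert]
      exact QuasiProjVar.inter_nonempty (hU r) (isOpen_biInter_finset fun r _ => hU r) (hne r) ih
  simpa using this Finset.univ

/-- An affine open subset on which the members of given bases of the linear series do not vanish. -/
structure AdaptedChart {k : ℕ} (E : Fin k → LinearSeries X) extends AffineChart X where
  ι : Fin k → Type
  fintype : ∀ i, Fintype (ι i)
  decEq : ∀ i, DecidableEq (ι i)
  b : ∀ i, Module.Basis (ι i) ℂ (E i).E
  /-- a distinguished element of each basis -/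
  o : ∀ i, ι i
  not_vanishesAt : ∀ x ∈ P, ∀ i l, ¬ (E i).VanishesAt (b i l) x
  ratio_mem : ∀ i l m, (fun x : P => (E i).ratio (b i l) (b i m) x.1) ∈ A

attribute [instance] AdaptedChart.fintype AdaptedChart.decEq

theorem nonempty_adaptedChart {k : ℕ} (E : Fin k → LinearSeries X) :
    Nonempty (AdaptedChart E) := by
  let ι : Fin k → Type := fun i => Fin (Module.finrank ℂ (E i).E)
  let b : ∀ i, Module.Basis (ι i) ℂ (E i).E := fun i => Module.finBasis ℂ (E i).E
  let κ := Σ i, ι i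
  let O : Set X.Pt := ⋂ p : κ, {x | ¬ (E p.1).VanishesAt (b p.1 p.2) x}
  have hO : IsOpen O := isOpen_iInter_of_finite fun p : κ => (E p.1).isOpen_not_vanishesAt _
  have hne : O.Nonempty := QuasiProjVar.iInter_nonempty
    (fun p : κ => (E p.1).isOpen_not_vanishesAt _)
    fun p => (E p.1).exists_not_vanishesAt ((b p.1).ne_zero p.2)
  have hOnv : ∀ x ∈ O, ∀ i l, ¬ (E i).VanishesAt (b i l) x := fun x hx i l =>
    Set.mem_iInter.1 hx ⟨i, l⟩
  obtain ⟨P, hPO, A, hP, hPne, hfg, hpt, hreg, hA⟩ := exists_affine_nbhd hO hne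
    (fun (r : Σ i, ι i × ι i) (x : O) => (E r.1).ratio (b r.1 r.2.1) (b r.1 r.2.2) x.1)
    fun r => (E r.1).ratio_mem_regularFun _ _ fun x hx => hOnv x hx _ _
  -- Only the existence of an index matters here: a base-point free series on a nonempty variety has
  -- a nonempty basis.
  have ho : ∀ i, ∃ l, ¬ (E i).VanishesAt (b i l) (Classical.arbitrary X.Pt) := fun i =>
    (E i).exists_not_vanishesAt_of_span (b i).span_eq _
  exact ⟨{
    P := P
    A := A
    isOpen := hP
    nonempty := hPne
    fg := hfg
    exists_point := hpt
    le_regularFun := hreg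
    ι := ι
    fintype := fun i => inferInstance
    decEq := fun i => inferInstance
    b := b
    o := fun i => (ho i).choose
    not_vanishesAt := fun x hx => hOnv x (hPO hx)
    ratio_mem := fun i l m => hA ⟨i, l, m⟩ }⟩

namespace AdaptedChart

variable {k : ℕ} {E : Fin k → LinearSeries X} (F : AdaptedChart E)

/-- The index set of the coordinates on the space of systems. -/
abbrev Idx : Type := Σ i, F.ι i

/-- The indices of the free coordinates of the systems vanishing at a given point. -/
abbrev Free : Type := {p : F.Idx // p.2 ≠ F.o p.1}

/-- The coordinates of a system. -/
def crd (s : Systems E) (p : F.Idx) : ℂ := (Pi.basis F.b).repr s p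

/-- The quotients of members of the bases, as elements of the coordinate ring. -/
def rho (i : Fin k) (l m : F.ι i) : F.A := ⟨_, F.ratio_mem i l m⟩

theorem rho_self (i : Fin k) (l : F.ι i) : F.rho i l l = 1 :=
  Subtype.ext (funext fun x => (E i).ratio_self (F.not_vanishesAt x.1 x.2 i l))

theorem rho_mul_rho (i : Fin k) (l m n : F.ι i) : F.rho i l m * F.rho i m n = F.rho i l n :=
  Subtype.ext (funext fun x => (E i).ratio_mul_ratio _ (F.not_vanishesAt x.1 x.2 i m))

/-- The coordinates of the generic system with a root. -/
def gen (p : F.Idx) : MvPolynomial F.Free F.A :=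
  -- The coefficient at `o` is fixed by the others, because its factor `rho i (o i) (o i)` in the
  -- equation of a root is `1`.
  if h : p.2 ≠ F.o p.1 then MvPolynomial.X ⟨p, h⟩ else
    -∑ l, if h : l ≠ F.o p.1 then
      MvPolynomial.X ⟨⟨p.1, l⟩, h⟩ * MvPolynomial.C (F.rho p.1 l (F.o p.1)) else 0

theorem gen_free (u : F.Free) : F.gen u.1 = MvPolynomial.X u := dif_pos u.2

theorem gen_o (i : Fin k) : F.gen ⟨i, F.o i⟩ =
    -∑ l ∈ Finset.univ.erase (F.o i), F.gen ⟨i, l⟩ * MvPolynomial.C (F.rho i l (F.o i)) := by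
  rw [gen, dif_neg (by simp), ← Finset.add_sum_erase _ _ (Finset.mem_univ (F.o i)),
    dif_neg (by simp), zero_add]
  congr 1
  refine Finset.sum_congr rfl fun l hl => ?_
  have h := Finset.ne_of_mem_erase hl
  rw [dif_pos h, F.gen_free ⟨⟨i, l⟩, h⟩]

theorem sum_gen_mul_rho (i : Fin k) :
    ∑ l, F.gen ⟨i, l⟩ * MvPolynomial.C (F.rho i l (F.o i)) = 0 := by
  rw [← Finset.add_sum_erase _ _ (Finset.mem_univ (F.o i)), F.gen_o i, rho_self, map_one, mul_one,
    neg_add_cancel]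

/-- The restriction of polynomial functions on the space of systems to the incidence variety. -/
def theta : MvPolynomial F.Idx ℂ →ₐ[ℂ] MvPolynomial F.Free F.A := MvPolynomial.aeval F.gen

/-- The linear equations on `σ` force its coefficients at `o i`, so `ψ ∘ theta` and evaluation at
`σ` agree on every coordinate. -/
theorem eval_theta (ψ : MvPolynomial F.Free F.A →ₐ[ℂ] ℂ) (σ : F.Idx → ℂ)
    (hσ : ∀ i, ∑ l, σ ⟨i, l⟩ * ψ (MvPolynomial.C (F.rho i l (F.o i))) = 0)
    (hψ : ∀ u : F.Free, ψ (MvPolynomial.X u) = σ u.1) (q : MvPolynomial F.Idx ℂ) :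
    ψ (F.theta q) = MvPolynomial.aeval σ q := by
  have : ψ.comp F.theta = MvPolynomial.aeval σ := by
    refine MvPolynomial.algHom_ext fun ⟨i, l⟩ => ?_
    have hfree : ∀ l (h : l ≠ F.o i), ψ (F.gen ⟨i, l⟩) = σ ⟨i, l⟩ := fun l h => by
      rw [F.gen_free ⟨⟨i, l⟩, h⟩, hψ]
    rw [AlgHom.comp_apply, theta, MvPolynomial.aeval_X, MvPolynomial.aeval_X]
    by_cases h : l = F.o i
    · subst h
      have h1 := hσ i
      rw [← Finset.add_sum_erase _ _ (Finset.mem_univ (F.o i)), rho_self, map_one, map_one,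
        mul_one] at h1
      rw [gen_o, map_neg, map_sum, eq_neg_of_add_eq_zero_left h1]
      congr 1
      refine Finset.sum_congr rfl fun l hl => ?_
      rw [map_mul, hfree l (Finset.ne_of_mem_erase hl)]
    · exact hfree l h
  exact DFunLike.congr_fun this q

/-- Evaluation at a point of the chart and given values of the free coordinates. -/
def evalAt (x : F.P) (u : F.Free → ℂ) : MvPolynomial F.Free F.A →ₐ[ℂ] ℂ :=
  MvPolynomial.aevalTower ((Pi.evalAlgHom ℂ (fun _ : F.P => ℂ) x).comp F.A.val) u

theorem evalAt_C (x : F.P) (u : F.Free → ℂ) (a : F.A) :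
    F.evalAt x u (MvPolynomial.C a) = a.1 x := MvPolynomial.aevalTower_C _ _ _

theorem evalAt_X (x : F.P) (u : F.Free → ℂ) (p : F.Free) :
    F.evalAt x u (MvPolynomial.X p) = u p := MvPolynomial.aevalTower_X _ _ _

/-- At a fixed `x` the coefficients become complex numbers, and a complex polynomial is determined
by its values. -/
theorem eq_zero_of_evalAt (r : MvPolynomial F.Free F.A) (h : ∀ x u, F.evalAt x u r = 0) :
    r = 0 := by
  refine MvPolynomial.ext _ _ fun m => Subtype.ext (funext fun x => ?_)
  let ev : F.A →+* ℂ := ((Pi.evalAlgHom ℂ (fun _ : F.P => ℂ) x).comp F.A.val).toRingHom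
  have h1 : MvPolynomial.map ev r = 0 := by
    refine MvPolynomial.funext fun u => ?_
    rw [MvPolynomial.eval_map, map_zero]
    exact h x u
  have h2 := congrArg (MvPolynomial.coeff m) h1
  rw [MvPolynomial.coeff_map] at h2
  exact h2

theorem vanishesAt_iff_sum_crd (s : Systems E) (i : Fin k) {e : (E i).E} {x : X.Pt}
    (he : ¬ (E i).VanishesAt e x) :
    (E i).VanishesAt (s i) x ↔ ∑ l, F.crd s ⟨i, l⟩ * (E i).ratio (F.b i l) e x = 0 := by
  rw [(E i).vanishesAt_iff_ratio he]
  conv_lhs => rw [← (F.b i).sum_repr (s i)]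
  rw [LinearSeries.ratio_sum]
  simp only [crd, Pi.basis_repr]

theorem exists_crd_eq (σ : F.Idx → ℂ) : ∃ s, F.crd s = σ :=
  ⟨(Pi.basis F.b).equivFun.symm σ, (Pi.basis F.b).equivFun.apply_symm_apply σ⟩

/-- Specializing the generic system at a point of the chart and at values of the free coordinates
gives a system having that point as a root. -/
theorem theta_eq_zero_of_forall (q : MvPolynomial F.Idx ℂ)
    (h : ∀ s, (∃ x, x ∈ zeroSet E s) → MvPolynomial.aeval (F.crd s) q = 0) : F.theta q = 0 := by
  refine F.eq_zero_of_evalAt _ fun x u => ?_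
  obtain ⟨s, hs⟩ := F.exists_crd_eq fun p => F.evalAt x u (F.gen p)
  have hsum : ∀ i, ∑ l, F.crd s ⟨i, l⟩ * (F.rho i l (F.o i)).1 x = 0 := by
    intro i
    rw [hs, ← map_zero (F.evalAt x u), ← F.sum_gen_mul_rho i, map_sum]
    refine Finset.sum_congr rfl fun l _ => ?_
    rw [map_mul, evalAt_C]
  rw [F.eval_theta (F.evalAt x u) (F.crd s) (fun i => ?_) (fun p => ?_)]
  · refine h s ⟨x.1, fun i => ?_⟩
    rw [F.vanishesAt_iff_sum_crd s i (F.not_vanishesAt x.1 x.2 i (F.o i))]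
    exact hsum i
  · simp only [evalAt_C]
    exact hsum i
  · rw [hs]
    simp only [gen_free]

/-- The open set where the members of the bases with given indices do not vanish. -/
def dom (j : ∀ i, F.ι i) : Set X.Pt := {x | ∀ i, ¬ (E i).VanishesAt (F.b i (j i)) x}

theorem isOpen_dom (j : ∀ i, F.ι i) : IsOpen (F.dom j) := by
  have : F.dom j = ⋂ i, {x | ¬ (E i).VanishesAt (F.b i (j i)) x} := by
    ext x; simp [dom]
  rw [this]
  exact isOpen_iInter_of_finite fun i => (E i).isOpen_not_vanishesAt _

theorem exists_mem_dom (x : X.Pt) : ∃ j, x ∈ F.dom j := by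
  choose j hj using fun i => (E i).exists_not_vanishesAt_of_span (F.b i).span_eq x
  exact ⟨j, hj⟩

/-- A polynomial identity between regular functions holds if it holds on a dense set. -/
theorem aeval_eq_zero_of_dense {ι : Type*} {W : Set X.Pt} (hW : IsOpen W) (v : ι → X.Pt → ℂ)
    (hv : ∀ l, (fun x : W => v l x.1) ∈ regularFun W) (q : MvPolynomial ι ℂ)
    (h : ∀ x ∈ W, x ∈ F.P → MvPolynomial.aeval (fun l => v l x) q = 0) {x : X.Pt} (hx : x ∈ W) :
    MvPolynomial.aeval (fun l => v l x) q = 0 := by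
  have key : ∀ y : W, MvPolynomial.aeval (fun l => v l y.1) q =
      MvPolynomial.aeval (fun (l : ι) (z : W) => v l z.1) q y := fun y =>
    (aeval_fun_apply (fun (l : ι) (z : W) => v l z.1) q y).symm
  have hmem : MvPolynomial.aeval (fun (l : ι) (z : W) => v l z.1) q ∈ regularFun W := by
    have : MvPolynomial.aeval (fun (l : ι) (z : W) => v l z.1) q ∈
        Algebra.adjoin ℂ (Set.range fun (l : ι) (z : W) => v l z.1) := by
      rw [Algebra.adjoin_range_eq_range_aeval]
      exact ⟨q, rfl⟩
    exact Algebra.adjoin_le (by rintro _ ⟨l, rfl⟩; exact hv l) this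
  rw [key ⟨x, hx⟩]
  refine regularFun_eq_zero_of_dense hW F.isOpen F.nonempty hmem (fun y hy hyP => ?_) ⟨x, hx⟩
  rw [← key ⟨y, hy⟩]
  exact h y hy hyP

/-- The root `x` may lie outside the chart. Correcting one coefficient of each equation of `s`
yields a system that vanishes at a variable point `z` and equals `s` at `z = x`. The identity holds
for `z` in the dense chart, hence at `x`. -/
theorem aeval_crd_eq_zero {q : MvPolynomial F.Idx ℂ} (hq : F.theta q = 0) {s : Systems E}
    {x : X.Pt} (hx : x ∈ zeroSet E s) : MvPolynomial.aeval (F.crd s) q = 0 := by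
  obtain ⟨j, hj⟩ := F.exists_mem_dom x
  -- the projection of `s` to the systems vanishing at `z`
  let v : F.Idx → X.Pt → ℂ := fun p z => F.crd s p - if p.2 = j p.1 then
    ∑ l, F.crd s ⟨p.1, l⟩ * (E p.1).ratio (F.b p.1 l) (F.b p.1 (j p.1)) z else 0
  have hvx : (fun p => v p x) = F.crd s := by
    funext p
    simp only [v]
    rw [(F.vanishesAt_iff_sum_crd s p.1 (hj p.1)).1 (hx p.1), ite_self, sub_zero]
  rw [← hvx]
  refine F.aeval_eq_zero_of_dense (F.isOpen_dom j) v (fun p => ?_) q (fun z hz hzP => ?_) hj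
  · have h1 : (fun z : F.dom j => v p z.1) = algebraMap ℂ (F.dom j → ℂ) (F.crd s p) -
        if p.2 = j p.1 then ∑ l, F.crd s ⟨p.1, l⟩ • fun z : F.dom j =>
          (E p.1).ratio (F.b p.1 l) (F.b p.1 (j p.1)) z.1 else 0 := by
      funext z
      simp only [v]
      split_ifs <;> simp
    rw [h1]
    refine sub_mem (Subalgebra.algebraMap_mem _ _) ?_
    split_ifs
    · exact Subalgebra.sum_mem _ fun l _ => Subalgebra.smul_mem _
        ((E p.1).ratio_mem_regularFun _ _ (W := F.dom j) fun z hz => hz p.1) _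
    · exact zero_mem _
  · have hsum : ∀ i, ∑ l, v ⟨i, l⟩ z * (F.rho i l (F.o i)).1 ⟨z, hzP⟩ = 0 := by
      intro i
      have h2 : ∀ l, (F.rho i l (F.o i)).1 ⟨z, hzP⟩ =
          (E i).ratio (F.b i l) (F.b i (j i)) z * (F.rho i (j i) (F.o i)).1 ⟨z, hzP⟩ := fun l =>
        ((E i).ratio_mul_ratio _ (hz i)).symm
      have h3 : (E i).ratio (F.b i (j i)) (F.b i (j i)) z = 1 := (E i).ratio_self (hz i)
      have h4 : ∑ l, v ⟨i, l⟩ z * (F.rho i l (F.o i)).1 ⟨z, hzP⟩ =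
          (∑ l, v ⟨i, l⟩ z * (E i).ratio (F.b i l) (F.b i (j i)) z) *
            (F.rho i (j i) (F.o i)).1 ⟨z, hzP⟩ := by
        rw [Finset.sum_mul]
        exact Finset.sum_congr rfl fun l _ => by rw [mul_assoc, ← h2 l]
      rw [h4]
      refine mul_eq_zero_of_left ?_ _
      simp only [v, sub_mul, ite_mul, zero_mul, Finset.sum_sub_distrib, Finset.sum_ite_eq',
        Finset.mem_univ, if_true, h3, mul_one, sub_self]
    rw [← F.eval_theta (F.evalAt ⟨z, hzP⟩ fun u => v u.1 z) (fun p => v p z) (fun i => ?_)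
      (fun u => F.evalAt_X _ _ _) q, hq, map_zero]
    simp only [evalAt_C]
    exact hsum i

theorem aeval_crd_mem_polyFun (q : MvPolynomial F.Idx ℂ) :
    (fun s => MvPolynomial.aeval (F.crd s) q) ∈ polyFun (Systems E) := by
  induction q using MvPolynomial.induction_on with
  | C r =>
    simp only [MvPolynomial.aeval_C]
    exact (polyFun (Systems E)).algebraMap_mem r
  | add p q hp hq =>
    simp only [map_add]
    exact add_mem hp hq
  | mul_X p n hp =>
    simp only [map_mul, MvPolynomial.aeval_X]
    exact mul_mem hp (Algebra.subset_adjoin ⟨(Pi.basis F.b).coord n, rfl⟩)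

theorem exists_aeval_crd_of_mem_polyFun {f : Systems E → ℂ} (hf : f ∈ polyFun (Systems E)) :
    ∃ q : MvPolynomial F.Idx ℂ, ∀ s, f s = MvPolynomial.aeval (F.crd s) q := by
  induction hf using Algebra.adjoin_induction with
  | mem f hf =>
    obtain ⟨φ, rfl⟩ := hf
    refine ⟨∑ p, MvPolynomial.C (φ (Pi.basis F.b p)) * MvPolynomial.X p, fun s => ?_⟩
    conv_lhs => rw [← (Pi.basis F.b).sum_repr s]
    rw [map_sum (MvPolynomial.aeval (F.crd s))]
    refine (map_sum φ _ _).trans (Finset.sum_congr rfl fun p _ => ?_)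
    rw [map_smul, map_mul, MvPolynomial.aeval_C, MvPolynomial.aeval_X, smul_eq_mul]
    exact mul_comm _ _
  | algebraMap r => exact ⟨MvPolynomial.C r, fun s => (MvPolynomial.aeval_C _ r).symm⟩
  | add f g _ _ hf hg =>
    obtain ⟨p, hp⟩ := hf
    obtain ⟨q, hq⟩ := hg
    exact ⟨p + q, fun s => by rw [map_add, ← hp, ← hq]; rfl⟩
  | mul f g _ _ hf hg =>
    obtain ⟨p, hp⟩ := hf
    obtain ⟨q, hq⟩ := hg
    exact ⟨p * q, fun s => by rw [map_mul, ← hp, ← hq]; rfl⟩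

theorem isClosed_aeval_crd (T : Set (MvPolynomial F.Idx ℂ)) :
    IsClosed[zariski (Systems E)] {s | ∀ q ∈ T, MvPolynomial.aeval (F.crd s) q = 0} := by
  rw [isClosed_zariski_iff]
  refine ⟨(fun q s => MvPolynomial.aeval (F.crd s) q) '' T, ?_, by ext; simp⟩
  rintro _ ⟨q, -, rfl⟩
  exact F.aeval_crd_mem_polyFun q

/-- By `aeval_crd_eq_zero` and `theta_eq_zero_of_forall` the kernel of `theta` consists exactly of
the polynomials vanishing on all systems with a root. -/
theorem mem_consistencyVariety_iff (s : Systems E) :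
    s ∈ consistencyVariety E ↔ ∀ q, F.theta q = 0 → MvPolynomial.aeval (F.crd s) q = 0 := by
  let _ := zariski (Systems E)
  have himg : ∀ t, t ∈ Prod.snd '' incidence E ↔ ∃ x, x ∈ zeroSet E t := fun t =>
    ⟨by rintro ⟨⟨x, t⟩, h, rfl⟩; exact ⟨x, h⟩, fun ⟨x, h⟩ => ⟨(x, t), h, rfl⟩⟩
  constructor
  · intro hs q hq
    have hle : consistencyVariety E ⊆
        {s | ∀ q ∈ {q | F.theta q = 0}, MvPolynomial.aeval (F.crd s) q = 0} :=
      closure_minimal (fun t ht q hq => by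
        obtain ⟨x, hx⟩ := (himg t).1 ht
        exact F.aeval_crd_eq_zero hq hx) (F.isClosed_aeval_crd _)
    exact hle hs q hq
  · intro hs
    refine Set.mem_sInter.2 fun Z hZ' => ?_
    obtain ⟨hZ, hsub⟩ := hZ'
    obtain ⟨S, hS, rfl⟩ := isClosed_zariski_iff.1 hZ
    intro f hf
    obtain ⟨q, hq⟩ := F.exists_aeval_crd_of_mem_polyFun (hS hf)
    rw [hq]
    refine hs q (F.theta_eq_zero_of_forall q fun t ht => ?_)
    rw [← hq]
    exact hsub ((himg t).2 ht) f hf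

instance : Algebra.FiniteType ℂ (MvPolynomial F.Free F.A) :=
  Algebra.FiniteType.trans (S := F.A) inferInstance inferInstance

/-- A general system in the consistency variety has a root. -/
theorem exists_root_of_general : ∃ a, F.theta a ≠ 0 ∧ ∀ s ∈ consistencyVariety E,
    MvPolynomial.aeval (F.crd s) a ≠ 0 → ∃ x, x ∈ zeroSet E s := by
  obtain ⟨a, ha, hext⟩ := exists_extension (K := ℂ) (C := MvPolynomial F.Idx ℂ)
    (B := MvPolynomial F.Free F.A) F.theta
  refine ⟨a, ha, fun s hs hsa => ?_⟩
  -- Evaluation at `s` extends to a character of the coordinate ring of the incidence variety, and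
  -- its restriction to `A` is the root.
  obtain ⟨ψ, hψ⟩ := hext (MvPolynomial.aeval (F.crd s))
    (fun c hc => (F.mem_consistencyVariety_iff s).1 hs c hc) hsa
  obtain ⟨x, hx⟩ := F.exists_point
    (ψ.comp (IsScalarTower.toAlgHom ℂ F.A (MvPolynomial F.Free F.A)))
  refine ⟨x.1, fun i => ?_⟩
  rw [F.vanishesAt_iff_sum_crd s i (F.not_vanishesAt x.1 x.2 i (F.o i)), ← map_zero ψ,
    ← F.sum_gen_mul_rho i, map_sum]
  refine Finset.sum_congr rfl fun l _ => ?_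
  rw [map_mul]
  refine congrArg₂ (· * ·) ?_ (hx (F.rho i l (F.o i))).symm
  have := hψ (MvPolynomial.X ⟨i, l⟩)
  rw [theta, MvPolynomial.aeval_X, MvPolynomial.aeval_X] at this
  exact this.symm

end AdaptedChart
end Generic
end
end LinSys

/-! ### Roots of the generic system, roots of general systems, and the theorem. -/

namespace LinSys
noncomputable section
section Main

/-- Values at a generic point of the target of a dominant morphism extend to values on a
finitely generated algebra. -/
theorem exists_generic_values {K D Ω κ ι : Type*} [Field K] [CommRing D] [Algebra K D]
    [Field Ω] [IsAlgClosed Ω] [Algebra K Ω] [Finite κ] (y : κ → D) (c : ι → κ)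
    (g : MvPolynomial ι K →ₐ[K] Ω)
    (h : ∀ q, MvPolynomial.aeval (fun p => y (c p)) q = 0 ↔ g q = 0) :
    ∃ V : κ → Ω, (∀ P : MvPolynomial κ K, MvPolynomial.aeval y P = 0 →
      MvPolynomial.aeval V P = 0) ∧ ∀ p, V (c p) = g (MvPolynomial.X p) := by
  -- Only the subalgebra generated by the finitely many `y` matters. It is of finite type even if
  -- `D` is not.
  let φ : MvPolynomial κ K →ₐ[K] D := MvPolynomial.aeval y
  have hft : Algebra.FiniteType K φ.range :=
    Algebra.FiniteType.of_surjective φ.rangeRestrict φ.rangeRestrict_surjective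
  obtain ⟨χ, hχ⟩ := exists_lift_generic (φ.rangeRestrict.comp (MvPolynomial.rename c)) g
    fun q => by
      rw [← h q, ← Subtype.val_inj]
      change MvPolynomial.aeval y (MvPolynomial.rename c q) = 0 ↔ _
      rw [MvPolynomial.aeval_rename]
      rfl
  have hV : ∀ P, MvPolynomial.aeval (fun l => χ (φ.rangeRestrict (MvPolynomial.X l))) P =
      χ (φ.rangeRestrict P) := fun P => by
    have : MvPolynomial.aeval (fun l => χ (φ.rangeRestrict (MvPolynomial.X l))) =
        χ.comp φ.rangeRestrict := MvPolynomial.algHom_ext fun l => by simp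
    exact DFunLike.congr_fun this P
  refine ⟨fun l => χ (φ.rangeRestrict (MvPolynomial.X l)), fun P hP => ?_, fun p => ?_⟩
  · rw [hV, show φ.rangeRestrict P = 0 from Subtype.ext hP, map_zero]
  · rw [← hχ, AlgHom.comp_apply, MvPolynomial.rename_X]

/-- A domain over a field embeds into an algebraically closed field. -/
theorem exists_injective_algHom (K R : Type) [Field K] [CommRing R] [IsDomain R] [Algebra K R] :
    ∃ (Ω : Type) (_ : Field Ω) (_ : IsAlgClosed Ω) (_ : Algebra K Ω) (j : R →ₐ[K] Ω),
      Function.Injective j := by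
  let Ω := AlgebraicClosure (FractionRing R)
  let g : R →+* Ω := (algebraMap (FractionRing R) Ω).comp (algebraMap R (FractionRing R))
  let _ : Algebra K Ω := (g.comp (algebraMap K R)).toAlgebra
  exact ⟨Ω, inferInstance, inferInstance, inferInstance, { g with commutes' := fun _ => rfl },
    (algebraMap (FractionRing R) Ω).injective.comp (IsFractionRing.injective R (FractionRing R))⟩

variable {X : QuasiProjVar} {k : ℕ} {E : Fin k → LinearSeries X}

/-- No proper subcollection attains the minimal defect, so the whole collection does. -/
theorem IsEssential.defect_univ_lt (hE : IsEssential E) {J : Finset (Fin k)}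
    (hJ : J ≠ Finset.univ) : defect E Finset.univ < defect E J := by
  obtain ⟨J₀, -, hJ₀⟩ := Finset.exists_mem_eq_inf' (s := Finset.univ) Finset.univ_nonempty
    (defect E)
  have h : J₀ = Finset.univ := by
    by_contra h
    exact (hE J₀ (Finset.ssubset_univ_iff.2 h)).ne hJ₀
  rw [← h]
  exact hJ₀.symm.trans_lt (hE J (Finset.ssubset_univ_iff.2 hJ))

namespace AdaptedChart

variable (F : AdaptedChart E)

/-- A root of the generic system, which is a specialization of the generic point of the variety,
has the same image under the Kodaira maps as the generic point. -/
theorem eq_of_generic_root (hE : IsEssential E) {Ω : Type*} [Field Ω] [Algebra ℂ Ω]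
    {φ : MvPolynomial F.Free F.A →ₐ[ℂ] Ω} (hφ : Function.Injective φ) (j : ∀ i, F.ι i)
    (v : ∀ i, F.ι i → Ω) (hv : ∀ i, v i (j i) = 1)
    (hsv : ∀ i, ∑ l, φ (F.gen ⟨i, l⟩) * v i l = 0)
    (hspec : ∀ P : MvPolynomial F.Idx ℂ,
      MvPolynomial.aeval (fun p : F.Idx => φ (MvPolynomial.C (F.rho p.1 p.2 (j p.1)))) P = 0 →
      MvPolynomial.aeval (fun p : F.Idx => v p.1 p.2) P = 0) (i : Fin k) (l : F.ι i) :
    v i l = v i (F.o i) * φ (MvPolynomial.C (F.rho i l (F.o i))) := by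
  classical
  by_contra hcon
  let ψ : F.A →ₐ[ℂ] Ω := φ.comp (IsScalarTower.toAlgHom ℂ F.A (MvPolynomial F.Free F.A))
  have hψ : Function.Injective ψ := hφ.comp (MvPolynomial.C_injective F.Free F.A)
  have hone : ∀ i l, φ (MvPolynomial.C (F.rho i l l)) = 1 := fun i l => by
    rw [rho_self, map_one, map_one]
  have hmul : ∀ i l m n, φ (MvPolynomial.C (F.rho i l m)) * φ (MvPolynomial.C (F.rho i m n)) =
      φ (MvPolynomial.C (F.rho i l n)) := fun i l m n => by
    rw [← map_mul, ← map_mul, rho_mul_rho]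
  have htau : ∀ J : Finset (Fin k), (tau E J : ℕ∞) = algRank ℂ
      ((fun p : F.Idx => φ (MvPolynomial.C (F.rho p.1 p.2 (F.o p.1)))) '' {p | p.1 ∈ J}) :=
    fun J => tau_eq_algRank E (fun i => (F.b i).span_eq) F.toAffineChart F.not_vanishesAt
      F.ratio_mem ψ hψ F.o J
  let J : Finset (Fin k) := {i | ∀ l, v i l = v i (F.o i) * φ (MvPolynomial.C (F.rho i l (F.o i)))}
  have hJ : J ≠ Finset.univ := fun h => by
    have : i ∈ J := h ▸ Finset.mem_univ i
    exact hcon ((Finset.mem_filter.1 this).2 l)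
  have hr : (tau E Finset.univ : ℕ∞) =
      algRank ℂ (Set.range fun p : F.Idx => φ (MvPolynomial.C (F.rho p.1 p.2 (F.o p.1)))) := by
    rw [htau, ← Set.image_univ]
    congr 2
    ext; simp
  have hcount := algRank_count (K := ℂ) F.o j
    (fun i l => φ (MvPolynomial.C (F.rho i l (F.o i)))) v (fun i l => φ (F.gen ⟨i, l⟩)) hv
    (fun i => by
      rw [← map_zero φ, ← F.sum_gen_mul_rho i, map_sum]
      simp only [map_mul])
    hsv (fun i => hone i _) J (fun i => by simp [J]) (tau E Finset.univ) (tau E J) hr.ge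
    (by
      rw [hr]
      -- Specialization bounds the rank of `v` by that of the generic quotients with denominators
      -- `j`, and these are rational in the quotients with denominators `o`.
      refine (algRank_range_le_of_specialization _ _ hspec).trans (algRank_le_of_subset_algCl ?_)
      rintro _ ⟨⟨i, l⟩, rfl⟩
      have h0 : φ (MvPolynomial.C (F.rho i (j i) (F.o i))) ≠ 0 := fun h0 => by
        have := hmul i (j i) (F.o i) (j i)
        rw [h0, zero_mul, hone] at this
        exact zero_ne_one this
      have h1 := eq_div_of_mul_eq h0 (hmul i l (j i) (F.o i))
      simp only [h1]
      exact div_mem (subset_algCl _ ⟨⟨i, l⟩, rfl⟩) (subset_algCl _ ⟨⟨i, j i⟩, rfl⟩))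
    (htau J).le
    (by
      have h := algRank_image_union_range_X_ge φ hφ
        (Set.range fun p : F.Idx => F.rho p.1 p.2 (F.o p.1))
      rw [← Set.range_comp] at h
      rw [hr, Nat.card_eq_fintype_card]
      have hX : (Set.range fun u : F.Free => φ (MvPolynomial.X u)) =
          Set.range fun u : F.Free => φ (F.gen u.1) := by simp only [gen_free]
      rw [hX] at h
      exact h)
  have := hE.defect_univ_lt hJ
  simp only [defect, Finset.card_univ, Fintype.card_fin] at this hcount
  omega

/-- A relation in the ring of the chart holds at the points of the chart, and by density on all of
`dom j`. -/
theorem aeval_ratio_eq_zero (j : ∀ i, F.ι i) {P : MvPolynomial F.Idx ℂ}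
    (hP : MvPolynomial.aeval (fun p : F.Idx => F.rho p.1 p.2 (j p.1)) P = 0) {x : X.Pt}
    (hx : x ∈ F.dom j) :
    MvPolynomial.aeval
      (fun p : F.Idx => (E p.1).ratio (F.b p.1 p.2) (F.b p.1 (j p.1)) x) P = 0 := by
  refine F.aeval_eq_zero_of_dense (F.isOpen_dom j)
    (fun (p : F.Idx) z => (E p.1).ratio (F.b p.1 p.2) (F.b p.1 (j p.1)) z)
    (fun p => (E p.1).ratio_mem_regularFun _ _ (W := F.dom j) fun z hz => hz p.1) P
    (fun z _ hzP => ?_) hx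
  have : ((Pi.evalAlgHom ℂ (fun _ : F.P => ℂ) ⟨z, hzP⟩).comp F.A.val).comp
      (MvPolynomial.aeval (fun p : F.Idx => F.rho p.1 p.2 (j p.1))) =
      MvPolynomial.aeval fun p : F.Idx => (E p.1).ratio (F.b p.1 p.2) (F.b p.1 (j p.1)) z :=
    MvPolynomial.algHom_ext fun p => by
      rw [AlgHom.comp_apply, MvPolynomial.aeval_X, MvPolynomial.aeval_X]
      rfl
  rw [← this, AlgHom.comp_apply, hP, map_zero]

/-- Two roots of a general system in the consistency variety have proportional coordinates. -/
theorem exists_ratio_eq_of_general (hE : IsEssential E) (j j' : ∀ i, F.ι i) (i : Fin k)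
    (m : F.ι i) : ∃ q, F.theta q ≠ 0 ∧ ∀ s x x', x ∈ F.dom j → x' ∈ F.dom j' →
      x ∈ zeroSet E s → x' ∈ zeroSet E s → MvPolynomial.aeval (F.crd s) q ≠ 0 →
      (E i).ratio (F.b i m) (F.b i (j' i)) x' =
        (E i).ratio (F.b i (j i)) (F.b i (j' i)) x' *
          (E i).ratio (F.b i m) (F.b i (j i)) x := by
  by_contra! hcon
  -- The counterexamples form `W`. By `hcon` their systems satisfy no polynomial relations beyond
  -- the kernel of `theta`, so the generic system lifts to a pair of roots over `Ω`.
  let W : Set (X.Pt × X.Pt × Systems E) := {w | w.1 ∈ F.dom j ∧ w.2.1 ∈ F.dom j' ∧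
    w.1 ∈ zeroSet E w.2.2 ∧ w.2.1 ∈ zeroSet E w.2.2 ∧
    (E i).ratio (F.b i m) (F.b i (j' i)) w.2.1 ≠
      (E i).ratio (F.b i (j i)) (F.b i (j' i)) w.2.1 * (E i).ratio (F.b i m) (F.b i (j i)) w.1}
  let v₁ : F.Idx → W → ℂ := fun p w => (E p.1).ratio (F.b p.1 p.2) (F.b p.1 (j p.1)) w.1.1
  let v₂ : F.Idx → W → ℂ := fun p w => (E p.1).ratio (F.b p.1 p.2) (F.b p.1 (j' p.1)) w.1.2.1
  let c : F.Idx → W → ℂ := fun p w => F.crd w.1.2.2 p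
  -- The last coordinate inverts the difference of the two sides, so that the inequality survives
  -- the lift.
  let y : ((F.Idx ⊕ F.Idx) ⊕ F.Idx) ⊕ Unit → W → ℂ := Sum.elim (Sum.elim (Sum.elim v₁ v₂) c)
    fun _ => (v₂ ⟨i, m⟩ - v₂ ⟨i, j i⟩ * v₁ ⟨i, m⟩)⁻¹
  obtain ⟨Ω, _, _, _, φ, hφ⟩ := exists_injective_algHom ℂ (MvPolynomial F.Free F.A)
  obtain ⟨V, hV, hVc⟩ := exists_generic_values y (fun p => Sum.inl (Sum.inr p)) (φ.comp F.theta)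
    fun q => by
      rw [AlgHom.comp_apply, map_eq_zero_iff φ hφ]
      change MvPolynomial.aeval c q = 0 ↔ _
      constructor
      · intro h
        by_contra hq
        obtain ⟨s, x, x', h1, h2, h3, h4, h5, h6⟩ := hcon q hq
        refine h5 ?_
        have := congrFun h ⟨(x, x', s), h1, h2, h3, h4, h6⟩
        rwa [aeval_fun_apply] at this
      · intro h
        funext w
        rw [aeval_fun_apply]
        exact F.aeval_crd_eq_zero h w.2.2.2.1
  have hVc' : ∀ p, V (Sum.inl (Sum.inr p)) = φ (F.gen p) := fun p => by
    rw [hVc, AlgHom.comp_apply, theta, MvPolynomial.aeval_X]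
  have hroot : ∀ (j : ∀ i, F.ι i) (ξ : W → X.Pt), (∀ w, ξ w ∈ F.dom j) →
      (∀ w, ξ w ∈ zeroSet E w.1.2.2) → ∀ inj : F.Idx → ((F.Idx ⊕ F.Idx) ⊕ F.Idx) ⊕ Unit,
      (∀ p w, y (inj p) w = (E p.1).ratio (F.b p.1 p.2) (F.b p.1 (j p.1)) (ξ w)) →
      ((∀ i, V (inj ⟨i, j i⟩) = 1) ∧ ∀ i l, V (inj ⟨i, l⟩) =
        V (inj ⟨i, F.o i⟩) * φ (MvPolynomial.C (F.rho i l (F.o i)))) := by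
    intro j ξ hdom hzero inj hy
    have h1 : ∀ i, V (inj ⟨i, j i⟩) = 1 := fun i => by
      have := hV (MvPolynomial.X (inj ⟨i, j i⟩) - 1) (funext fun w => by
        rw [map_sub, map_one, MvPolynomial.aeval_X, Pi.sub_apply, hy,
          (E i).ratio_self (hdom w i)]
        exact sub_self _)
      rwa [map_sub, map_one, MvPolynomial.aeval_X, sub_eq_zero] at this
    refine ⟨h1, F.eq_of_generic_root hE hφ j (fun i l => V (inj ⟨i, l⟩)) h1 (fun i => ?_)
      fun P hP => ?_⟩
    · have := hV (∑ l, MvPolynomial.X (Sum.inl (Sum.inr ⟨i, l⟩)) * MvPolynomial.X (inj ⟨i, l⟩))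
        (funext fun w => by
          simp only [map_sum, map_mul, MvPolynomial.aeval_X, Finset.sum_apply, Pi.mul_apply, hy]
          exact (F.vanishesAt_iff_sum_crd w.1.2.2 i (hdom w i)).1 (hzero w i))
      simpa only [map_sum, map_mul, MvPolynomial.aeval_X, hVc'] using this
    · have hP' : MvPolynomial.aeval (fun p : F.Idx => F.rho p.1 p.2 (j p.1)) P = 0 := by
        refine (hφ.comp (MvPolynomial.C_injective F.Free F.A)) ?_
        have : (φ.comp (IsScalarTower.toAlgHom ℂ F.A (MvPolynomial F.Free F.A))).comp
            (MvPolynomial.aeval fun p : F.Idx => F.rho p.1 p.2 (j p.1)) = MvPolynomial.aeval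
            fun p : F.Idx => φ (MvPolynomial.C (F.rho p.1 p.2 (j p.1))) :=
          MvPolynomial.algHom_ext fun p => by
            rw [AlgHom.comp_apply, MvPolynomial.aeval_X, MvPolynomial.aeval_X]
            rfl
        rw [Function.comp_apply, Function.comp_apply, map_zero, map_zero]
        exact (DFunLike.congr_fun this P).trans hP
      have := hV (MvPolynomial.rename inj P) (funext fun w => by
        rw [MvPolynomial.aeval_rename, aeval_fun_apply]
        simp only [Function.comp_apply, hy]
        exact F.aeval_ratio_eq_zero j hP' (hdom w))
      rwa [MvPolynomial.aeval_rename] at this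
  obtain ⟨h1, h1'⟩ := hroot j (fun w => w.1.1) (fun w => w.2.1) (fun w => w.2.2.2.1)
    (fun p => Sum.inl (Sum.inl (Sum.inl p))) fun _ _ => rfl
  obtain ⟨-, h2'⟩ := hroot j' (fun w => w.1.2.1) (fun w => w.2.2.1) (fun w => w.2.2.2.2.1)
    (fun p => Sum.inl (Sum.inl (Sum.inr p))) fun _ _ => rfl
  have h3 := hV (MvPolynomial.X (Sum.inr ()) *
    (MvPolynomial.X (Sum.inl (Sum.inl (Sum.inr ⟨i, m⟩))) -
      MvPolynomial.X (Sum.inl (Sum.inl (Sum.inr ⟨i, j i⟩))) *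
      MvPolynomial.X (Sum.inl (Sum.inl (Sum.inl ⟨i, m⟩)))) - 1) (funext fun w => by
    simp only [map_sub, map_mul, map_one, MvPolynomial.aeval_X]
    exact sub_eq_zero.2 (inv_mul_cancel₀ (sub_ne_zero.2 w.2.2.2.2.2)))
  simp only [map_sub, map_mul, map_one, MvPolynomial.aeval_X] at h3
  -- Both lifted roots are multiples of the generic root, so the difference that was inverted is
  -- zero.
  have h4 := h1 i
  rw [h1' i (j i)] at h4
  rw [h2' i m, h2' i (j i), h1' i m] at h3
  generalize V (Sum.inl (Sum.inl (Sum.inl ⟨i, F.o i⟩))) = a at h3 h4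
  generalize V (Sum.inl (Sum.inl (Sum.inr ⟨i, F.o i⟩))) = a' at h3
  generalize V (Sum.inr ()) = u at h3
  generalize φ (MvPolynomial.C (F.rho i m (F.o i))) = r at h3
  generalize φ (MvPolynomial.C (F.rho i (j i) (F.o i))) = r' at h3 h4
  refine one_ne_zero (α := Ω) ?_
  linear_combination -h3 - u * a' * r * h4

/-- The evaluations at `x` and `x'` are proportional on each `E i`, with nonzero factor. Hence `x'`
also lies in `dom j`, and all quotients with denominators `b (j i)` agree at the two points. -/
theorem kodaira_eq_of_ratio_eq {x x' : X.Pt} {j j' : ∀ i, F.ι i} (hx : x ∈ F.dom j)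
    (hx' : x' ∈ F.dom j') (h : ∀ i m, (E i).ratio (F.b i m) (F.b i (j' i)) x' =
      (E i).ratio (F.b i (j i)) (F.b i (j' i)) x' * (E i).ratio (F.b i m) (F.b i (j i)) x) :
    (subProd E Finset.univ).kodaira x' = (subProd E Finset.univ).kodaira x := by
  have h0 : ∀ i, (E i).ratio (F.b i (j i)) (F.b i (j' i)) x' ≠ 0 := fun i h0 => by
    have := h i (j' i)
    rw [h0, zero_mul, (E i).ratio_self (hx' i)] at this
    exact one_ne_zero this
  have hxj : x' ∈ F.dom j := fun i => mt ((E i).vanishesAt_iff_ratio (hx' i)).1 (h0 i)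
  refine (LinearSeries.prod fun i : (Finset.univ : Finset (Fin k)) => E i).kodaira_eq_of_ratio_eq
    (LinearSeries.span_range_prodMem (fun i : (Finset.univ : Finset (Fin k)) => E i)
      (b := fun i => F.b i) fun i => (F.b i).span_eq)
    (e := LinearSeries.prodMem _ fun i => F.b i (j i)) ?_ ?_ fun l => ?_
  · rw [LinearSeries.vanishesAt_prodMem_iff]
    rintro ⟨i, hi⟩
    exact hxj i hi
  · rw [LinearSeries.vanishesAt_prodMem_iff]
    rintro ⟨i, hi⟩
    exact hx i hi
  · rw [LinearSeries.ratio_prodMem, LinearSeries.ratio_prodMem]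
    refine Finset.prod_congr rfl fun i _ => mul_left_cancel₀ (h0 i) ?_
    rw [← h i (l i), mul_comm, (E i).ratio_mul_ratio _ (hxj i)]

theorem exists_isClosed_zeroSet_eq (F : AdaptedChart E) (hE : IsEssential E) :
    ∃ B : Set (Systems E), IsClosed[zariski (Systems E)] B ∧ B ⊂ consistencyVariety E ∧
      ∀ s ∈ consistencyVariety E \ B, ∃ y ∈ Set.range (subProd E Finset.univ).kodaira,
        zeroSet E s = (subProd E Finset.univ).kodaira ⁻¹' {y} := by
  obtain ⟨a, ha, hroot⟩ := F.exists_root_of_general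
  choose q hq hqW using F.exists_ratio_eq_of_general hE
  -- Where `Q ≠ 0`, the factor `a` provides a root and the factors `q` make all roots have the same
  -- image. Finitely many suffice because the sets `dom j` cover `X`.
  let Q : MvPolynomial F.Idx ℂ := a * ∏ t : (∀ i, F.ι i) × (∀ i, F.ι i) × F.Idx,
    q t.1 t.2.1 t.2.2.1 t.2.2.2
  have hQ : F.theta Q ≠ 0 := by
    rw [map_mul, map_prod]
    exact mul_ne_zero ha (Finset.prod_ne_zero_iff.2 fun t _ => hq _ _ _ _)
  refine ⟨{s | ∀ p ∈ {p | F.theta p = 0 ∨ p = Q}, MvPolynomial.aeval (F.crd s) p = 0},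
    F.isClosed_aeval_crd _, ⟨fun s hs => ?_, fun hle => hQ ?_⟩, ?_⟩
  · exact (F.mem_consistencyVariety_iff s).2 fun p hp => hs p (Or.inl hp)
  -- If `B` were everything, `Q` would vanish on all systems with a root, forcing `theta Q = 0`.
  · refine F.theta_eq_zero_of_forall Q fun s ⟨x, hx⟩ => hle ?_ Q (Or.inr rfl)
    exact (F.mem_consistencyVariety_iff s).2 fun p hp => F.aeval_crd_eq_zero hp hx
  · rintro s ⟨hs, hsB⟩
    have hsQ : MvPolynomial.aeval (F.crd s) Q ≠ 0 := fun h => hsB fun p hp =>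
      hp.elim ((F.mem_consistencyVariety_iff s).1 hs p) fun hp => hp ▸ h
    rw [map_mul, map_prod] at hsQ
    obtain ⟨x, hx⟩ := hroot s hs (left_ne_zero_of_mul hsQ)
    have hsq := Finset.prod_ne_zero_iff.1 (right_ne_zero_of_mul hsQ)
    refine ⟨_, ⟨x, rfl⟩, Set.Subset.antisymm (fun x' hx' => ?_) fun x' hx' i => ?_⟩
    · obtain ⟨j, hj⟩ := F.exists_mem_dom x
      obtain ⟨j', hj'⟩ := F.exists_mem_dom x'
      exact F.kodaira_eq_of_ratio_eq hj hj' fun i m =>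
        hqW j j' i m s x x' hj hj' hx hx' (hsq (j, j', ⟨i, m⟩) (Finset.mem_univ _))
    -- Vanishing of `s i` at a point depends only on the image under Φ_E, so the fibre of a root
    -- consists of roots.
    · exact LinearSeries.vanishesAt_of_kodaira_prod_eq
        (fun i : (Finset.univ : Finset (Fin k)) => E i) (Eq.symm hx') ⟨i, Finset.mem_univ i⟩ (s i)
        (hx i)

end AdaptedChart
end Main
end
end LinSys

theorem mainTheorem8 (X : LinSys.QuasiProjVar) (k : ℕ) (E : Fin k → LinSys.LinearSeries X)
    (hE : LinSys.IsEssential E) :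
    ∃ B : Set (LinSys.Systems E),
      IsClosed[LinSys.zariski (LinSys.Systems E)] B ∧ B ⊂ LinSys.consistencyVariety E ∧
      ∀ s ∈ LinSys.consistencyVariety E \ B,
        ∃ y ∈ Set.range (LinSys.subProd E Finset.univ).kodaira,
          LinSys.zeroSet E s = (LinSys.subProd E Finset.univ).kodaira ⁻¹' {y} := by
  obtain ⟨F⟩ := LinSys.nonempty_adaptedChart E
  exact F.exists_isClosed_zeroSet_eq hE
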